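/- Let $\mathfrak h=\mathbb Z\langle x,y\rangle$, $\mathfrak h^1=\mathbb Z+y\mathfrak h$, $\mathfrak h^{\ge2}=\mathbb Z+yx\,\mathbb Z\langle x,yx\rangle$, and let $q$ be an indeterminate. **Truncated values.** For $N\ge1$ define the following elements of $\mathbb Z[[q]]$ (each equal to $1$ for the empty index). For $k_1,\dots,k_r\in\{\bar1\}\cup\mathbb Z_{\ge1}$ with $r=0$ or $k_r\ne\bar1$, where $\bar1$ is a formal symbol, $$\zeta^\dagger_{q,N}(k_1,\dots,k_r)=\sum_{\substack{0<n_1\le\cdots\le n_r<N\\ n_i<n_{i+1}\ (k_i\ne\bar1)}}\ \prod_{k_j=\bar1}\frac1{1-q^{N-n_j}}\prod_{k_j\ne\bar1}\frac{q^{n_j}}{(1-q^{n_j})^{k_j}}.$$ For $k_1,\dots,k_r\in\mathbb Z_{\ge1}$, $$\zeta^{\mathrm{BZ}}_{q,N}(k_1,\dots,k_r)=\sum_{0<n_1<\cdots<n_r<N}\ \prod_{j=1}^r\frac{q^{n_j(k_j-1)}}{(1-q^{n_j})^{k_j}},$$ and, if $r=0$ or $k_r\ge2$, $$\zeta^{\diamondsuit,\mathrm{BZ}}_{q,N}(k_1,\dots,k_r)=\sum_{A\subset\{i\mid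 k_i=1\}}\ \sum_{\substack{0<n_1\le\cdots\le n_r<N\\ n_i<n_{i+1}\ (i\notin A)}}\ \prod_{i\in A}\frac{q^{N-n_i}}{1-q^{N-n_i}}\prod_{i\notin A}\frac{q^{n_i(k_i-1)}}{(1-q^{n_i})^{k_i}}.$$ Let $Z^\dagger_{q,N},Z^{\mathrm{BZ}}_{q,N}:\mathfrak h^1\to\mathbb Z[[q]]$ be the $\mathbb Z$-linear maps sending $yx^{k_1-1}\cdots yx^{k_r-1}$ to $\zeta^\dagger_{q,N}(k_1,\dots,k_r)$ and to $\zeta^{\mathrm{BZ}}_{q,N}(k_1,\dots,k_r)$ respectively (in particular $1\mapsto1$). **Combinatorial notation.** Let $[n]=\{1,\dots,n\}$. Let $\mathcal T(r)$ be the set of all $S\cup S'\subset[2r]$ with $S\cap S'=\emptyset$, where $S$ is a union of sets $\{2j,2j+1\}$ with $1\le j\le r-1$, and $S'$ is a union of sets $\{2j-1,2j\}$ with $1\le j\le r$ and has no two elements differing by exactly $2$. Put $\kappa(T)=\#T/2$ for $T\in\mathcal T(r)$. For a finite set $B\subset\mathbb Z_{>0}$ put - $\mathrm{eo}(B)=\#\{j\ge1\mid\{2j,2j+1\}\subset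 B\}$, - $\alpha(B)=\#\{i\ge0\mid B\cap\{2i,2i+1\}\ne\emptyset\}$, - $\beta(B)=\#\{i\ge1\mid B\cap\{2i-1,2i\}\ne\emptyset\}$, and, if $A\cap B=\emptyset$, $\beta_A(B)=\beta(\{\sigma_A(b)\mid b\in B\})$ with $\sigma_A(b)=\#([b]\setminus A)$. For $\boldsymbol c=(c_1,\dots,c_{2r})\in\mathbb Z_{\ge1}^{2r}$ let $P_1=\{i\mid c_i=1\}$ and $P_{>1}=\{i\mid c_i>1\}$; for $A\subset P_1$, $B\subset P_{>1}$, let $\boldsymbol c_{A,B}$ be obtained from $\boldsymbol c$ by subtracting $1$ from the entries at positions in $B$ and deleting the entries at positions in $A$. **The elements $\mathfrak E_q$ and $\mathfrak D_q$.** For $\epsilon\in\{0,1\}$ define $\mathfrak E^\epsilon_q(\boldsymbol c)\in\mathfrak h$ recursively by $\mathfrak E^\epsilon_q(\emptyset)=1$ and, for $r\ge1$, $$\begin{aligned}\mathfrak E^\epsilon_q(\boldsymbol c)={}&-\sum_{\emptyset\ne B\subset P_{>1}}(-1)^{\#B}\,\mathfrak E^\epsilon_q(\boldsymbol c_{\emptyset,B})\,x^{\alpha(B)}+\sum_{\emptyset\ne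 B\subset P_{>1}}(-1)^{\#B}\,\mathfrak E^\epsilon_q(\boldsymbol c_{\emptyset,B})\sum_{h=\alpha(B)+1}^{\beta(B)}yx^{h-1}\\&+\sum_{\substack{\emptyset\ne A\subset P_1,\ A\in\mathcal T(r)\\ B\subset P_{>1}}}\ \sum_{h=1}^{\kappa(A)}(-1)^{\mathrm{eo}(A)+\#B+\kappa(A)-h}\binom{\kappa(A)-1}{h-1}\,\mathfrak E^\epsilon_q(\boldsymbol c_{A,B})\,yx^{h+\epsilon\kappa(A)+\beta_A(B)-1},\end{aligned}$$ where $\sum_{h=a+1}^{b}$ means $-\sum_{h=b+1}^{a}$ if $a>b$. Then $\mathfrak E^0_q(\boldsymbol c)\in\mathfrak h^1$ and $\mathfrak E^1_q(\boldsymbol c)\in\mathfrak h^{\ge2}$. Put $$\mathfrak E_q(\boldsymbol c)=\mathfrak E^0_q(\boldsymbol c)\in\mathfrak h^1,\qquad \mathfrak D_q(\boldsymbol c)=(-1)^{c_1+\cdots+c_{2r}}\,\theta(\mathfrak E^1_q(\boldsymbol c))\in\mathfrak h^{\ge2}\subset\mathfrak h^1,$$ where $\theta$ is the $\mathbb Z$-algebra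 automorphism of $\mathfrak h$ with $\theta(x)=-x$, $\theta(y)=-y$. **Theorem.** For all $N\ge1$, $r\ge0$ and $k_1,\dots,k_r,l_1,\dots,l_r\in\mathbb Z_{\ge1}$, $$\begin{aligned}\zeta^\dagger_{q,N}(\{\bar1\}^{l_1-1},k_1,\dots,\{\bar1\}^{l_r-1},k_r)&=Z^\dagger_{q,N}\bigl(\mathfrak E_q(l_1,k_1,\dots,l_r,k_r)\bigr),\\ \zeta^{\diamondsuit,\mathrm{BZ}}_{q,N}(\{1\}^{l_1-1},k_1+1,\dots,\{1\}^{l_r-1},k_r+1)&=Z^{\mathrm{BZ}}_{q,N}\bigl(\mathfrak D_q(l_1,k_1,\dots,l_r,k_r)\bigr),\end{aligned}$$ where $\{a\}^m$ denotes $m$ consecutive entries equal to $a$. -/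

import Mathlib

namespace QMZV

/-! ### The noncommutative polynomial algebra -/

/-- The two letters `x` and `y`. -/
inductive Letter
  | x
  | y

/-- `𝔥 = ℤ⟨x, y⟩`. -/
abbrev H : Type := FreeAlgebra ℤ Letter

/-- The `ℤ`-module structure on `𝔥` is that of the algebra. -/
noncomputable instance instModuleH : Module ℤ H := Algebra.toModule

/-- The generator `x` of `𝔥`. -/
noncomputable def hx : H := FreeAlgebra.ι ℤ Letter.x

/-- The generator `y` of `𝔥`. -/
noncomputable def hy : H := FreeAlgebra.ι ℤ Letter.y

/-- `𝔥¹ = ℤ + y𝔥`. -/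
noncomputable def H1 : Submodule ℤ H :=
  Submodule.span ℤ {1} ⊔ LinearMap.range (LinearMap.mulLeft ℤ hy)

/-- The subalgebra `ℤ⟨x, yx⟩` of `𝔥`. -/
noncomputable def Sub2 : Subalgebra ℤ H := Algebra.adjoin ℤ {hx, hy * hx}

/-- `yx ℤ⟨x, yx⟩`. -/
noncomputable def J2 : Submodule ℤ H :=
  (Subalgebra.toSubmodule Sub2).map (LinearMap.mulLeft ℤ (hy * hx))

/-- `𝔥^{≥2} = ℤ + yx ℤ⟨x, yx⟩`. -/
noncomputable def Hge2 : Submodule ℤ H := Submodule.span ℤ {1} ⊔ J2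

/-- The `ℤ`-algebra endomorphism `θ` of `𝔥` with `θ(x) = -x` and `θ(y) = -y`
(an involution, hence an automorphism). -/
noncomputable def theta : H →ₐ[ℤ] H :=
  FreeAlgebra.lift ℤ fun a => -FreeAlgebra.ι ℤ a

/-! ### Truncated `q`-multiple zeta values, as elements of `ℤ⟦q⟧` with `q = PowerSeries.X` -/

open PowerSeries in
/-- `1 / (1 - q^n)` as a power series in `q`, for `n ≥ 1`. -/
noncomputable def qinv (n : ℕ) : ℤ⟦X⟧ := invOfUnit (1 - X ^ n) 1

/-- For `n ≥ 1`, `qinv n` is the inverse of `1 - q^n`. -/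
theorem mul_qinv {n : ℕ} (hn : 1 ≤ n) : (1 - PowerSeries.X ^ n) * qinv n = 1 := by
  apply PowerSeries.mul_invOfUnit
  have : n ≠ 0 := by omega
  simp [this]

/-- An entry of an index: the formal symbol `1̄`, or an integer `k` (which is positive wherever
entries are used). -/
inductive Entry
  | bar
  | int (k : ℕ)
  deriving DecidableEq

/-- `ζ†_{q,N}(k_1, …, k_r)`: the sum over `0 < n_1 ≤ ⋯ ≤ n_r < N` with `n_i < n_{i+1}` whenever
`k_i ≠ 1̄`; an entry `1̄` contributes `1 / (1 - q^{N - n_j})`, an integer `k_j` contributes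
`q^{n_j} / (1 - q^{n_j})^{k_j}`. -/
noncomputable def zetaDagger (N : ℕ) (k : List Entry) : PowerSeries ℤ :=
  ∑ n ∈ (Fintype.piFinset fun _ : Fin k.length => Finset.Ioo 0 N) with
      (∀ i j : Fin k.length, (j : ℕ) = i + 1 →
        n i ≤ n j ∧ (k.get i ≠ Entry.bar → n i < n j)),
    ∏ j, match k.get j with
      | Entry.bar => qinv (N - n j)
      | Entry.int m => PowerSeries.X ^ n j * qinv (n j) ^ m

/-- The truncated Bradley--Zhao value `ζ^{BZ}_{q,N}(k_1, …, k_r)`. -/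
noncomputable def zetaBZ (N : ℕ) (k : List ℕ) : PowerSeries ℤ :=
  ∑ n ∈ (Fintype.piFinset fun _ : Fin k.length => Finset.Ioo 0 N) with
      (∀ i j : Fin k.length, (j : ℕ) = i + 1 → n i < n j),
    ∏ j, PowerSeries.X ^ (n j * (k.get j - 1)) * qinv (n j) ^ k.get j

/-- The truncated diamond Bradley--Zhao value `ζ^{♢,BZ}_{q,N}(k_1, …, k_r)`. -/
noncomputable def zetaDiamondBZ (N : ℕ) (k : List ℕ) : PowerSeries ℤ :=
  ∑ A ∈ (Finset.univ.filter fun i : Fin k.length => k.get i = 1).powerset,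
    ∑ n ∈ (Fintype.piFinset fun _ : Fin k.length => Finset.Ioo 0 N) with
        (∀ i j : Fin k.length, (j : ℕ) = i + 1 → n i ≤ n j ∧ (i ∉ A → n i < n j)),
      (∏ i ∈ A, PowerSeries.X ^ (N - n i) * qinv (N - n i)) *
        ∏ i ∈ Aᶜ, PowerSeries.X ^ (n i * (k.get i - 1)) * qinv (n i) ^ k.get i

/-! ### The linear maps `Z†_{q,N}` and `Z^{BZ}_{q,N}` -/

/-- Parses a word as `x^m y x^{k_1 - 1} ⋯ y x^{k_r - 1}` and returns `(m, [k_1, …, k_r])`. -/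
def parse : List Letter → ℕ × List ℕ
  | [] => (0, [])
  | Letter.x :: w => ((parse w).1 + 1, (parse w).2)
  | Letter.y :: w => (0, ((parse w).1 + 1) :: (parse w).2)

/-- The linear map on `𝔥¹` that sends the word `y x^{k_1 - 1} ⋯ y x^{k_r - 1}` to
`f [k_1, …, k_r]`: the restriction to `𝔥¹` of the linear map on `𝔥` that does so and vanishes on
all words beginning with `x`. -/
noncomputable def linearOnWords (f : List ℕ → PowerSeries ℤ) : H1 →ₗ[ℤ] PowerSeries ℤ :=
  ((FreeAlgebra.basisFreeMonoid ℤ Letter).constr ℤ fun w : FreeMonoid Letter =>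
    if (parse w.toList).1 = 0 then f (parse w.toList).2 else 0).domRestrict H1

/-- `Z†_{q,N} : 𝔥¹ → ℤ⟦q⟧`, with `y x^{k_1 - 1} ⋯ y x^{k_r - 1} ↦ ζ†_{q,N}(k_1, …, k_r)`. -/
noncomputable def ZDagger (N : ℕ) : H1 →ₗ[ℤ] PowerSeries ℤ :=
  linearOnWords fun k => zetaDagger N (k.map Entry.int)

/-- `Z^{BZ}_{q,N} : 𝔥¹ → ℤ⟦q⟧`, with `y x^{k_1 - 1} ⋯ y x^{k_r - 1} ↦ ζ^{BZ}_{q,N}(k_1, …, k_r)`. -/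
noncomputable def ZBZ (N : ℕ) : H1 →ₗ[ℤ] PowerSeries ℤ :=
  linearOnWords fun k => zetaBZ N k

/-- The word `y x^{k_1 - 1} ⋯ y x^{k_r - 1}` as an element of `𝔥`. -/
noncomputable def word (k : List ℕ) : H := (k.map fun m => hy * hx ^ (m - 1)).prod

theorem word_mem (k : List ℕ) : word k ∈ H1 := by
  cases k with
  | nil => exact Submodule.mem_sup_left (Submodule.mem_span_singleton_self _)
  | cons m k =>
    refine Submodule.mem_sup_right ⟨hx ^ (m - 1) * word k, ?_⟩
    simp [word, mul_assoc]

/-- The defining property of `linearOnWords`. -/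
theorem linearOnWords_word (f : List ℕ → PowerSeries ℤ) (k : List ℕ) (hk : ∀ m ∈ k, 1 ≤ m) :
    linearOnWords f ⟨word k, word_mem k⟩ = f k := by
  have hp : ∀ (m : ℕ) (w : List Letter), parse (List.replicate m Letter.x ++ w)
      = ((parse w).1 + m, (parse w).2) := by
    intro m w
    induction m with
    | zero => rfl
    | succ m ih => simp [List.replicate_succ, parse, ih, add_assoc]
  have hb : ∀ w : List Letter,
      FreeAlgebra.basisFreeMonoid ℤ Letter (FreeMonoid.ofList w)
        = (w.map (FreeAlgebra.ι ℤ)).prod := by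
    intro w
    simp [FreeAlgebra.basisFreeMonoid, FreeAlgebra.equivMonoidAlgebraFreeMonoid,
      FreeMonoid.lift_apply]
    exact one_smul ℤ _
  have key : ∃ w : List Letter, parse w = (0, k) ∧ word k = (w.map (FreeAlgebra.ι ℤ)).prod := by
    induction k with
    | nil => exact ⟨[], rfl, rfl⟩
    | cons m k ih =>
      obtain ⟨w, hw, hw'⟩ := ih fun a ha => hk a (List.mem_cons_of_mem _ ha)
      have hm := hk m List.mem_cons_self
      refine ⟨Letter.y :: (List.replicate (m - 1) Letter.x ++ w), ?_, ?_⟩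
      · simp only [parse, hp, hw]
        simp
        omega
      · have : word (m :: k) = hy * hx ^ (m - 1) * word k := by simp [word]
        rw [this, hw']
        simp [hx, hy, mul_assoc]
  obtain ⟨w, hw, hw'⟩ := key
  have e : word k = FreeAlgebra.basisFreeMonoid ℤ Letter (FreeMonoid.ofList w) := by
    rw [hw', hb]
  rw [linearOnWords, LinearMap.domRestrict_apply]
  simp only [e]
  rw [Module.Basis.constr_basis]
  simp [hw]

/-! ### Combinatorics of subsets of `[2r] = Finset.Icc 1 (2 * r)` -/

/-- Unions of even-odd dominoes `{2j, 2j+1}`, `j ∈ [r-1]`. -/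
def EO (r : ℕ) : Finset (Finset ℕ) :=
  (Finset.Icc 1 (r - 1)).powerset.image fun R => R.biUnion fun j => {2 * j, 2 * j + 1}

/-- Unions of odd-even dominoes `{2j-1, 2j}`, `j ∈ [r]`. -/
def OE (r : ℕ) : Finset (Finset ℕ) :=
  (Finset.Icc 1 r).powerset.image fun R => R.biUnion fun j => {2 * j - 1, 2 * j}

/-- Members of `OE r` no two elements of which differ by `2`. -/
def OEstar (r : ℕ) : Finset (Finset ℕ) :=
  {S ∈ OE r | ∀ i ∈ S, ∀ j ∈ S, i ≠ j + 2}

/-- `𝒯(r)`: the disjoint unions of a member of `EO r` and a member of `OEstar r`. -/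
def Til (r : ℕ) : Finset (Finset ℕ) :=
  {P ∈ EO r ×ˢ OEstar r | Disjoint P.1 P.2}.image fun P => P.1 ∪ P.2

/-- `κ(T) = #T / 2`. -/
def kappa (T : Finset ℕ) : ℕ := T.card / 2

/-- `eo(S) = #{j ≥ 1 | {2j, 2j+1} ⊆ S}`. -/
def eo (S : Finset ℕ) : ℕ :=
  {j ∈ Finset.Icc 1 (S.sup id) | {2 * j, 2 * j + 1} ⊆ S}.card

/-- `α(B)`: the number of `i ≥ 0` such that `B` meets `{2i, 2i+1}`; here `i = ⌊b/2⌋` is the unique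
`i` with `b ∈ {2i, 2i+1}`. -/
def alpha (B : Finset ℕ) : ℕ := (B.image fun b => b / 2).card

/-- `β(B)`: the number of `i` such that `B` meets `{2i-1, 2i}`; here `i = ⌊(b+1)/2⌋` is the unique
`i` with `b ∈ {2i-1, 2i}`. -/
def beta (B : Finset ℕ) : ℕ := (B.image fun b => (b + 1) / 2).card

/-- `σ_A(i) = #([i] \ A)`. -/
def sigma (A : Finset ℕ) (i : ℕ) : ℕ := (Finset.Icc 1 i \ A).card

/-- `β_A(B) = β(σ_A(B))`. -/
def betaRel (A B : Finset ℕ) : ℕ := beta (B.image (sigma A))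

/-- `[n]_c^1`: the positions `i ∈ [n]` (counted from `1`) with `c_i = 1`. -/
def posOne (c : List ℕ) : Finset ℕ :=
  {i ∈ Finset.Icc 1 c.length | c.getD (i - 1) 0 = 1}

/-- `[n]_c^{>1}`: the positions `i ∈ [n]` (counted from `1`) with `c_i > 1`. -/
def posBig (c : List ℕ) : Finset ℕ :=
  {i ∈ Finset.Icc 1 c.length | 1 < c.getD (i - 1) 0}

/-- `c_{A,B}`, with positions counted from `s` (from `1` in the application): delete the entries at
the positions in `A` and subtract `1` from the entries at the positions in `B`. -/
def reduceFrom (s : ℕ) (A B : Finset ℕ) : List ℕ → List ℕ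
  | [] => []
  | a :: c =>
    if s ∈ A then reduceFrom (s + 1) A B c
    else (if s ∈ B then a - 1 else a) :: reduceFrom (s + 1) A B c

/-- `c_{A,B}`. -/
def reduce (c : List ℕ) (A B : Finset ℕ) : List ℕ := reduceFrom 1 A B c

theorem reduceFrom_sum_le (A B : Finset ℕ) (c : List ℕ) (s : ℕ) :
    (reduceFrom s A B c).sum ≤ c.sum := by
  induction c generalizing s with
  | nil => simp [reduceFrom]
  | cons a c ih =>
    have := ih (s + 1)
    simp only [reduceFrom]
    split_ifs <;> simp <;> omega

theorem reduceFrom_sum_lt (A B : Finset ℕ) (c : List ℕ) (s i : ℕ) (hi : i < c.length)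
    (hc : 0 < c.getD i 0) (h : s + i ∈ A ∨ s + i ∈ B) :
    (reduceFrom s A B c).sum < c.sum := by
  induction c generalizing s i with
  | nil => simp at hi
  | cons a c ih =>
    have hle := reduceFrom_sum_le A B c (s + 1)
    simp only [reduceFrom]
    cases i with
    | zero =>
      simp only [List.getD_cons_zero] at hc
      simp only [add_zero] at h
      rcases h with h | h
      · rw [if_pos h]; simp; omega
      · split_ifs <;> simp <;> omega
    | succ i =>
      have hlt := ih (s + 1) i (by simpa using hi) (by simpa using hc)
        (by rwa [show s + 1 + i = s + (i + 1) by ring])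
      split_ifs <;> simp <;> omega

theorem reduce_sum_lt {c : List ℕ} {A B : Finset ℕ} (hA : A ⊆ posOne c) (hB : B ⊆ posBig c)
    (h : (A ∪ B).Nonempty) : (reduce c A B).sum < c.sum := by
  obtain ⟨i, hi⟩ := h
  rw [Finset.mem_union] at hi
  have h1 : 1 ≤ i ∧ i ≤ c.length ∧ 0 < c.getD (i - 1) 0 := by
    rcases hi with hi | hi
    · have := hA hi
      simp only [posOne, Finset.mem_filter, Finset.mem_Icc] at this
      omega
    · have := hB hi
      simp only [posBig, Finset.mem_filter, Finset.mem_Icc] at this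
      omega
  refine reduceFrom_sum_lt A B c 1 (i - 1) (by omega) h1.2.2 ?_
  rwa [show 1 + (i - 1) = i by omega]

/-- The nonempty subsets of `[n]_c^{>1}`. -/
def indexB (c : List ℕ) : Finset (Finset ℕ) :=
  {B ∈ (posBig c).powerset | B.Nonempty}

/-- The pairs `(A, B)` with `∅ ≠ A ⊆ [n]_c^1`, `A ∈ 𝒯(n/2)` and `B ⊆ [n]_c^{>1}`. -/
def indexAB (c : List ℕ) : Finset (Finset ℕ × Finset ℕ) :=
  {A ∈ Til (c.length / 2) | A.Nonempty ∧ A ⊆ posOne c} ×ˢ (posBig c).powerset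

theorem reduce_lt_of_mem_indexB {c : List ℕ} {B : Finset ℕ} (h : B ∈ indexB c) :
    (reduce c ∅ B).sum < c.sum := by
  simp only [indexB, Finset.mem_filter, Finset.mem_powerset] at h
  exact reduce_sum_lt (Finset.empty_subset _) h.1 (by simpa using h.2)

theorem reduce_lt_of_mem_indexAB {c : List ℕ} {P : Finset ℕ × Finset ℕ} (h : P ∈ indexAB c) :
    (reduce c P.1 P.2).sum < c.sum := by
  simp only [indexAB, Finset.mem_product, Finset.mem_filter, Finset.mem_powerset] at h
  exact reduce_sum_lt h.1.2.2 h.2 (h.1.2.1.mono Finset.subset_union_left)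

/-! ### The elements `𝔈_q` and `𝔇_q` -/

/-- The recursively defined element `𝔈_q^ε(c)` of `𝔥`, where `ε ∈ {0, 1}` and `c` is a sequence of
even length with positive entries. The recursion is displayed in `wordE_eq`. -/
noncomputable def wordE (ε : ℕ) (c : List ℕ) : H :=
  if c = [] then 1 else
    -(∑ B ∈ (indexB c).attach,
        (-1 : ℤ) ^ B.1.card • (wordE ε (reduce c ∅ B.1) * hx ^ alpha B.1))
    + ∑ B ∈ (indexB c).attach,
        (-1 : ℤ) ^ B.1.card • (wordE ε (reduce c ∅ B.1) *
          ((∑ h ∈ Finset.Icc (alpha B.1 + 1) (beta B.1), hy * hx ^ (h - 1))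
            - ∑ h ∈ Finset.Icc (beta B.1 + 1) (alpha B.1), hy * hx ^ (h - 1)))
    + ∑ P ∈ (indexAB c).attach, ∑ h ∈ Finset.Icc 1 (kappa P.1.1),
        ((-1 : ℤ) ^ (eo P.1.1 + P.1.2.card + (kappa P.1.1 - h)) *
          ((kappa P.1.1 - 1).choose (h - 1) : ℤ)) •
          (wordE ε (reduce c P.1.1 P.1.2) *
            (hy * hx ^ (h + ε * kappa P.1.1 + betaRel P.1.1 P.1.2 - 1)))
  termination_by c.sum
  decreasing_by
    · exact reduce_lt_of_mem_indexB B.2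
    · exact reduce_lt_of_mem_indexB B.2
    · exact reduce_lt_of_mem_indexAB P.2

theorem wordE_nil (ε : ℕ) : wordE ε [] = 1 := by
  rw [wordE, if_pos rfl]

/-- The recursion for `𝔈_q^ε`. The sum over `α(B) < h ≤ β(B)` is to be read as
`-∑_{β(B) < h ≤ α(B)}` when `α(B) > β(B)`, hence the difference of two sums, at least one of which
is empty. -/
theorem wordE_eq (ε : ℕ) {c : List ℕ} (hc : c ≠ []) :
    wordE ε c =
      -(∑ B ∈ indexB c, (-1 : ℤ) ^ B.card • (wordE ε (reduce c ∅ B) * hx ^ alpha B))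
      + ∑ B ∈ indexB c, (-1 : ℤ) ^ B.card • (wordE ε (reduce c ∅ B) *
          ((∑ h ∈ Finset.Icc (alpha B + 1) (beta B), hy * hx ^ (h - 1))
            - ∑ h ∈ Finset.Icc (beta B + 1) (alpha B), hy * hx ^ (h - 1)))
      + ∑ P ∈ indexAB c, ∑ h ∈ Finset.Icc 1 (kappa P.1),
          ((-1 : ℤ) ^ (eo P.1 + P.2.card + (kappa P.1 - h)) *
            ((kappa P.1 - 1).choose (h - 1) : ℤ)) •
            (wordE ε (reduce c P.1 P.2) *
              (hy * hx ^ (h + ε * kappa P.1 + betaRel P.1 P.2 - 1))) := by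
  rw [wordE, if_neg hc]
  rw [← Finset.sum_attach (indexB c), ← Finset.sum_attach (indexB c),
    ← Finset.sum_attach (indexAB c)]

/-! ### Membership of `𝔈_q(c)` in `𝔥¹` and of `𝔇_q(c)` in `𝔥^{≥2}` -/

theorem reduceFrom_empty_length (B : Finset ℕ) (c : List ℕ) (s : ℕ) :
    (reduceFrom s ∅ B c).length = c.length := by
  induction c generalizing s with
  | nil => rfl
  | cons a c ih => simp [reduceFrom, ih]

/-- A common membership criterion. -/
theorem wordE_mem_of (ε d : ℕ) (hd : d ≤ 1) (hε : d ≤ ε) (J : Submodule ℤ H)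
    (hJx : ∀ u ∈ J, u * hx ∈ J) (hy1 : ∀ m, d ≤ m → hy * hx ^ m ∈ J)
    (hJy : ∀ u ∈ J, ∀ m, d ≤ m → u * (hy * hx ^ m) ∈ J) (c : List ℕ) (hc : c ≠ []) :
    wordE ε c ∈ J := by
  have hJxn : ∀ (n : ℕ), ∀ u ∈ J, u * hx ^ n ∈ J := by
    intro n
    induction n with
    | zero => intro u hu; simpa using hu
    | succ n ih => intro u hu; rw [pow_succ, ← mul_assoc]; exact hJx _ (ih u hu)
  induction hn : c.sum using Nat.strong_induction_on generalizing c with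
  | _ n ih =>
    subst hn
    rw [wordE_eq ε hc]
    have hne : ∀ B, reduce c ∅ B ≠ [] := by
      intro B h
      have := reduceFrom_empty_length B c 1
      rw [reduce] at h
      rw [h] at this
      exact hc (List.length_eq_zero_iff.mp this.symm)
    have hB : ∀ B ∈ indexB c, wordE ε (reduce c ∅ B) ∈ J := fun B h =>
      ih _ (reduce_lt_of_mem_indexB h) _ (hne B) rfl
    have hpos : ∀ B ∈ indexB c, 1 ≤ alpha B ∧ 1 ≤ beta B := by
      intro B h
      have h2 : B.Nonempty := (Finset.mem_filter.mp h).2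
      exact ⟨Finset.card_pos.mpr (h2.image _), Finset.card_pos.mpr (h2.image _)⟩
    refine J.add_mem (J.add_mem (J.neg_mem ?_) ?_) ?_
    · exact J.sum_mem fun B h => J.smul_mem _ (hJxn _ _ (hB B h))
    · refine J.sum_mem fun B h => J.smul_mem _ ?_
      rw [mul_sub, Finset.mul_sum, Finset.mul_sum]
      refine J.sub_mem (J.sum_mem fun m hm => ?_) (J.sum_mem fun m hm => ?_)
      all_goals
        have := hpos B h
        rw [Finset.mem_Icc] at hm
        exact hJy _ (hB B h) _ (by omega)
    · refine J.sum_mem fun P h => J.sum_mem fun m hm => J.smul_mem _ ?_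
      rw [Finset.mem_Icc] at hm
      have hk : d ≤ ε * kappa P.1 :=
        hε.trans (Nat.le_mul_of_pos_right _ (by omega))
      have hm' : d ≤ m + ε * kappa P.1 + betaRel P.1 P.2 - 1 := by omega
      by_cases h0 : reduce c P.1 P.2 = []
      · rw [h0, wordE_nil, one_mul]
        exact hy1 _ hm'
      · exact hJy _ (ih _ (reduce_lt_of_mem_indexAB h) _ h0 rfl) _ hm'

theorem wordE_mem_H1 (c : List ℕ) : wordE 0 c ∈ H1 := by
  by_cases hc : c = []
  · rw [hc, wordE_nil]
    exact Submodule.mem_sup_left (Submodule.mem_span_singleton_self _)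
  · refine Submodule.mem_sup_right
      (wordE_mem_of 0 0 (by omega) (by omega) _ ?_ ?_ ?_ c hc)
    · rintro _ ⟨v, rfl⟩
      exact ⟨v * hx, by simp [mul_assoc]⟩
    · intro m _
      exact ⟨hx ^ m, by simp⟩
    · rintro _ ⟨v, rfl⟩ m _
      exact ⟨v * (hy * hx ^ m), by simp [mul_assoc]⟩

theorem hx_mem_Sub2 : hx ∈ Sub2 := Algebra.subset_adjoin (by simp)

theorem hyx_mem_Sub2 : hy * hx ∈ Sub2 := Algebra.subset_adjoin (by simp)

theorem wordE_mem_Hge2 (c : List ℕ) : wordE 1 c ∈ Hge2 := by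
  have hyx : ∀ m, 1 ≤ m → hy * hx ^ m = hy * hx * hx ^ (m - 1) := by
    intro m hm
    obtain ⟨n, rfl⟩ : ∃ n, m = n + 1 := ⟨m - 1, by omega⟩
    simp [pow_succ', mul_assoc]
  by_cases hc : c = []
  · rw [hc, wordE_nil]
    exact Submodule.mem_sup_left (Submodule.mem_span_singleton_self _)
  · refine Submodule.mem_sup_right
      (wordE_mem_of 1 1 (by omega) (by omega) _ ?_ ?_ ?_ c hc)
    · rintro _ ⟨v, hv, rfl⟩
      exact ⟨v * hx, Sub2.mul_mem hv hx_mem_Sub2, by simp [mul_assoc]⟩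
    · intro m hm
      exact ⟨hx ^ (m - 1), Sub2.pow_mem hx_mem_Sub2 _, by simp [hyx m hm, mul_assoc]⟩
    · rintro _ ⟨v, hv, rfl⟩ m hm
      refine ⟨v * (hy * hx ^ m), Sub2.mul_mem hv ?_, by simp [mul_assoc]⟩
      rw [hyx m hm]
      exact Sub2.mul_mem hyx_mem_Sub2 (Sub2.pow_mem hx_mem_Sub2 _)

theorem theta_mem_Hge2 {u : H} (hu : u ∈ Hge2) : theta u ∈ Hge2 := by
  have tx : theta hx = -hx := by simp [theta, hx]
  have ty : theta hy = -hy := by simp [theta, hy]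
  have hS : Sub2 ≤ Sub2.comap theta := by
    refine Algebra.adjoin_le ?_
    rintro a (rfl | rfl)
    · change theta hx ∈ Sub2
      rw [tx]; exact Sub2.neg_mem hx_mem_Sub2
    · change theta (hy * hx) ∈ Sub2
      rw [map_mul, tx, ty, neg_mul_neg]; exact hyx_mem_Sub2
  obtain ⟨a, ha, b, ⟨v, hv, rfl⟩, rfl⟩ := Submodule.mem_sup.mp hu
  obtain ⟨z, rfl⟩ := Submodule.mem_span_singleton.mp ha
  rw [map_add]
  refine Hge2.add_mem (Submodule.mem_sup_left ?_) (Submodule.mem_sup_right ?_)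
  · exact Submodule.mem_span_singleton.mpr ⟨z, by rw [map_smul, map_one]; rfl⟩
  · exact ⟨theta v, hS hv, by simp [tx, ty]⟩

theorem Hge2_le_H1 : Hge2 ≤ H1 := by
  refine sup_le_sup le_rfl ?_
  rintro _ ⟨v, _, rfl⟩
  exact ⟨hx * v, by simp⟩

/-- `𝔈_q(c) = 𝔈_q^0(c) ∈ 𝔥¹`. -/
noncomputable def frakE (c : List ℕ) : H1 := ⟨wordE 0 c, wordE_mem_H1 c⟩

/-- `𝔇_q(c) = (-1)^{c_1 + ⋯ + c_{2r}} θ(𝔈_q^1(c)) ∈ 𝔥^{≥2}`. -/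
noncomputable def frakD (c : List ℕ) : Hge2 :=
  ⟨(-1 : ℤ) ^ c.sum • theta (wordE 1 c), Hge2.smul_mem _ (theta_mem_Hge2 (wordE_mem_Hge2 c))⟩

/-! ### The sequences in the theorem -/

/-- `(l_1, k_1, …, l_r, k_r)`. -/
def interleave {r : ℕ} (l k : Fin r → ℕ) : List ℕ :=
  (List.ofFn fun i => [l i, k i]).flatten

/-- `({1̄}^{l_1 - 1}, k_1, …, {1̄}^{l_r - 1}, k_r)`. -/
def daggerIndex {r : ℕ} (l k : Fin r → ℕ) : List Entry :=
  (List.ofFn fun i => List.replicate (l i - 1) Entry.bar ++ [Entry.int (k i)]).flatten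

/-- `({1}^{l_1 - 1}, k_1 + 1, …, {1}^{l_r - 1}, k_r + 1)`. -/
def diamondIndex {r : ℕ} (l k : Fin r → ℕ) : List ℕ :=
  (List.ofFn fun i => List.replicate (l i - 1) 1 ++ [k i + 1]).flatten

end QMZV

/-! Both identities are instances of one statement about a sequence `v` with `v (m + n) * (v m + v n
- 1) = v m * v n`, that is, `1 - 1 / v` is multiplicative: `v n = 1/(1 - q^n)` with `ε = 0`, and `v
n = 1 - 1/(1 - q^n)` with `ε = 1`, which amounts to replacing `q` by its inverse. In the second case
all signs are absorbed by `(-1)^(c.sum)` and `theta`.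

Truncated sums at level `N + 1` are expressed through those at level `N`, and the elements `𝔈_q` are
shown to obey the same recursion. Put a variable on each entry of `c` and form the generating
function of the sums over the sites `N - j, …, N - 1`. Adding a site on the left gives the recursion
`transfer`. Raising `N` with the smallest site fixed changes every factor that involves the distance
to `N`, and the algebraic identity `exchange` controls this: up to the explicit factors `pairProd`,
the generating function for `N + 1` is a signed sum, over the ways to delete dominoes from the word
of variables, of generating functions for `N` (`transfer_recursion`). The deleted sets are the
members of `𝒯(r)` (`sum_Til`). Expanding `pairProd` over blocks of two positions produces the
exponents `alpha` and `betaRel`, and reading off the coefficient attached to `c` gives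
`truncated_recursion`.

On the other side, passing from `N` to `N + 1` in a strict nested sum adds the terms whose last
index is `N`, so its increment is computed by stripping letters from the end of the word
(`IsIterated`). Applied to the definition of `𝔈_q`, this yields the same recursion
(`IsIterated.wordE_recursion`). As only `B = ∅` leaves `c` unchanged, the recursion determines the
values by induction on `N` and then on `c.sum` (`truncated_eq_iterated`). -/

namespace QMZV

/-! ### Tiling sums -/

/-- What the preceding domino of a tiling does to the current pair of letters: nothing, or it
covers the first letter of the pair, or it is the whole preceding pair. -/
inductive Gap
  | none
  | eo
  | oe

section Transfer

variable {S ι : Type*} [CommRing S]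

/-- The sum over the ways to delete dominoes from a word of even length, where dominoes in
even-odd position have weight `-c`, those in odd-even position have weight `c`, and an odd-even
domino has no odd-even neighbour and does not overlap the others. -/
def tilingSum (c : S) : List ι → Gap → (List ι → S) → S
  | [], .none, G => G []
  | [], .eo, _ => 0
  | [], .oe, G => G []
  | [_], _, _ => 0
  | s :: t :: w, .none, G =>
      tilingSum c w .none (fun o => G (s :: t :: o)) - c * tilingSum c w .eo (fun o => G (s :: o))
        + c * tilingSum c w .oe G
  | s :: t :: w, .oe, G =>
      tilingSum c w .none (fun o => G (s :: t :: o)) - c * tilingSum c w .eo (fun o => G (s :: o))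
  | _ :: t :: w, .eo, G =>
      tilingSum c w .none (fun o => G (t :: o)) - c * tilingSum c w .eo G

theorem tilingSum_linear (c a b : S) : ∀ (w : List ι) (σ : Gap) (G G' : List ι → S),
    tilingSum c w σ (fun o => a * G o + b * G' o)
      = a * tilingSum c w σ G + b * tilingSum c w σ G'
  | [], .none, _, _ => rfl
  | [], .eo, _, _ => by simp [tilingSum]
  | [], .oe, _, _ => rfl
  | [_], .none, _, _ => by simp [tilingSum]
  | [_], .eo, _, _ => by simp [tilingSum]
  | [_], .oe, _, _ => by simp [tilingSum]
  | s :: t :: w, .none, G, G' => by simp only [tilingSum, tilingSum_linear c a b w]; ring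
  | s :: t :: w, .eo, G, G' => by simp only [tilingSum, tilingSum_linear c a b w]; ring
  | s :: t :: w, .oe, G, G' => by simp only [tilingSum, tilingSum_linear c a b w]; ring

theorem tilingSum_zero (c : S) (w : List ι) (σ : Gap) :
    tilingSum c w σ (fun _ => 0) = 0 := by
  simpa using tilingSum_linear c 0 0 w σ (fun _ => 0) (fun _ => 0)

/-- The inhomogeneous part of the one-step recursion for `tilingSum`. -/
def tilingRest (c : S) (f : ι → ι → S) (W : List ι → S) (s : ι) : ι → List ι → S
  | t, [] => f s t
  | _, [_] => 0
  | t, s' :: t' :: w => f s t * W (s' :: t' :: w) - c * tilingRest c f W s t' w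

/-- In state `.oe` the first letter `s` always survives, so `g s` factors out. A run of even-odd
dominoes may delete `t` and the letters after it; `tilingRest` sums over which letter becomes the
partner of `s`, each domino in the run contributing `-c`. -/
theorem tilingSum_step {c : S} {g : ι → S} {f : ι → ι → S} {G G' : List ι → S}
    (h : ∀ s t o, G' (s :: t :: o) = g s * G (s :: t :: o) + f s t * G o) (h0 : G [] = 1)
    (s : ι) : ∀ (t : ι) (w : List ι),
    tilingSum c (s :: t :: w) .oe G' = g s * tilingSum c (s :: t :: w) .oe G
      + tilingRest c f (fun w => tilingSum c w .none G) s t w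
  | t, [] => by simp [tilingSum, tilingRest, h, h0]
  | t, [_] => by simp [tilingSum, tilingRest]
  | t, s' :: t' :: w => by
    have ih := tilingSum_step (c := c) h h0 s t' w
    -- Deleting the domino on `t`, `s'` leaves `s` followed by `t'`, again a word in state `.oe`.
    have e : ∀ G : List ι → S, tilingSum c (s :: t :: s' :: t' :: w) .oe G
        = tilingSum c (s' :: t' :: w) .none (fun o => G (s :: t :: o))
          - c * tilingSum c (s :: t' :: w) .oe G := fun _ => rfl
    rw [e, e, ih]
    simp only [h, tilingSum_linear, tilingRest]
    ring

/-- By `hf` the difference `f s t - f s' t` does not depend on `t`, so what is left is an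
alternating sum of `.none` sums. It telescopes because such a sum equals the `.oe` sum plus `c`
times the `.oe` sum of the word two letters shorter. -/
theorem tilingRest_sub {c : S} {g : ι → S} {f : ι → ι → S} {G : List ι → S} (h0 : G [] = 1)
    (hf : ∀ s s' t, f s t - f s' t = c * (g s - g s')) (s s' : ι) : ∀ (t : ι) (w : List ι),
    tilingRest c f (fun w => tilingSum c w .none G) s t w
      - tilingRest c f (fun w => tilingSum c w .none G) s' t w
      = c * (g s - g s') * tilingSum c w .oe G
  | t, [] => by simp [tilingRest, tilingSum, h0, hf]
  | t, [_] => by simp [tilingRest, tilingSum]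
  | t, a :: b :: w => by
    have ih := tilingRest_sub (c := c) h0 hf s s' b w
    have e : tilingSum c (a :: b :: w) .none G
      = tilingSum c (a :: b :: w) .oe G + c * tilingSum c w .oe G := rfl
    simp only [tilingRest]
    linear_combination (-c) * ih + tilingSum c (a :: b :: w) .none G * hf s s' t
      + c * (g s - g s') * e

theorem tilingSum_succ_pair {c : S} {g : ι → S} {f : ι → ι → S} {G G' : List ι → S}
    (h : ∀ s t o, G' (s :: t :: o) = g s * G (s :: t :: o) + f s t * G o) (h0 : G [] = 1)
    (h0' : G' [] = 1) (s t : ι) :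
    tilingSum c [s, t] .none G' = g s * tilingSum c [s, t] .none G + f s t + c * (1 - g s) := by
  simp only [tilingSum, h, h0, h0']
  ring

/-- Split the tilings by whether an odd-even domino covers `s`, `t`. If so, the leading letter is
`s'` and the factor is `g s'`; `tilingRest_sub` trades it for `g s`, and the remainders collapse to
one term. Its crossed arguments `s'`, `t` match the shifted pairing in `pairProd` of `t :: s' :: t'
:: w`. -/
theorem tilingSum_succ {c : S} {g : ι → S} {f : ι → ι → S} {G G' : List ι → S}
    (h : ∀ s t o, G' (s :: t :: o) = g s * G (s :: t :: o) + f s t * G o) (h0 : G [] = 1)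
    (hf : ∀ s s' t, f s t - f s' t = c * (g s - g s')) (s t s' t' : ι) (w : List ι) :
    tilingSum c (s :: t :: s' :: t' :: w) .none G'
      = g s * tilingSum c (s :: t :: s' :: t' :: w) .none G
        + f s' t * tilingSum c (s' :: t' :: w) .none G := by
  have e : ∀ (s t : ι) (w : List ι) (G : List ι → S), tilingSum c (s :: t :: w) .none G
      = tilingSum c (s :: t :: w) .oe G + c * tilingSum c w .oe G := fun _ _ _ _ => rfl
  have h1 := tilingSum_step (c := c) h h0 s t (s' :: t' :: w)
  have h2 := tilingSum_step (c := c) h h0 s' t' w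
  have h3 := tilingRest_sub (c := c) h0 hf s s' t (s' :: t' :: w)
  have h4 : tilingRest c f (fun w => tilingSum c w .none G) s' t (s' :: t' :: w)
    = f s' t * tilingSum c (s' :: t' :: w) .none G
      - c * tilingRest c f (fun w => tilingSum c w .none G) s' t' w := rfl
  rw [e s t _ G', e s t _ G]
  linear_combination h1 + c * h2 + h3 + h4

/-! ### The transfer recursion -/

/-- The product of `1 + v((1 - a)(1 - b) - 1)` over the consecutive pairs of letters, an unpaired
last letter contributing `1 + v((1 - a) - 1)`. -/
def pairProd (v : S) (X : ι → S) : List ι → S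
  | [] => 1
  | [a] => 1 - v * X a
  | a :: b :: w => (1 - v * X a - v * X b + v * X a * X b) * pairProd v X w

/-- The generating function of truncated sums over the sites `N - j, …, N - 1`; here `I n i`
stands for `1 / (1 - V n * X i)`. -/
def transfer (V : ℕ → S) (X : ι → S) (I : ℕ → ι → S) (ε N : ℕ) : ℕ → List ι → S
  | _, [] => 1
  | _, [_] => 0
  | 0, _ :: _ :: _ => 0
  | j + 1, s :: t :: w =>
      (1 - ε * X s * (1 - V (N - (j + 1)))) * I (j + 1) s * transfer V X I ε N j (s :: t :: w)
        + V (N - (j + 1)) ^ ε * (V (N - (j + 1)) - 1) * I (N - (j + 1)) t * I (j + 1) s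
          * transfer V X I ε N j w

variable {V : ℕ → S} {X : ι → S} {I : ℕ → ι → S}

theorem transfer_nil (ε N j : ℕ) : transfer V X I ε N j [] = 1 := by
  cases j <;> rfl

theorem transfer_singleton (ε N j : ℕ) (a : ι) : transfer V X I ε N j [a] = 0 := by
  cases j <;> rfl

theorem transfer_succ (ε N j : ℕ) (s t : ι) (w : List ι) :
    transfer V X I ε N (j + 1) (s :: t :: w) =
      (1 - ε * X s * (1 - V (N - (j + 1)))) * I (j + 1) s * transfer V X I ε N j (s :: t :: w)
        + V (N - (j + 1)) ^ ε * (V (N - (j + 1)) - 1) * I (N - (j + 1)) t * I (j + 1) s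
          * transfer V X I ε N j w := rfl

/-- The exchange identity behind the recursion in `N`. -/
theorem exchange {ε : ℕ} (hε : ε ≤ 1) {v x y a b t ia ib it : S} (hv : v * (x + y - 1) = x * y)
    (ha : (1 - y * a) * ia = 1) (hb : (1 - y * b) * ib = 1) (ht : (1 - x * t) * it = 1) :
    (1 - v * a - v * t + v * a * t) * (x ^ ε * (x - 1) * it * ia)
      - (1 - v * b - v * t + v * b * t) * (x ^ ε * (x - 1) * it * ib)
      = v ^ ε * (v - 1) * ((1 - ε * a * (1 - x)) * ia - (1 - ε * b * (1 - x)) * ib) := by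
  -- The identity with denominators cleared: its two sides differ by a multiple of the relation
  -- `hv`.
  have key : (1 - v * a - v * t + v * a * t) * (x ^ ε * (x - 1)) * (1 - y * b)
      - (1 - v * b - v * t + v * b * t) * (x ^ ε * (x - 1)) * (1 - y * a)
      = v ^ ε * (v - 1) * (1 - x * t)
        * ((1 - ε * a * (1 - x)) * (1 - y * b) - (1 - ε * b * (1 - x)) * (1 - y * a)) := by
    interval_cases ε
    · push_cast
      linear_combination (b - a) * (1 - t) * hv
    · push_cast
      linear_combination ((b - a) * (1 - t) * x - (a - b) * (v - 1) * (1 - x * t)) * hv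
  have e : ∀ p q : S, p = q → p * (ia * ib * it) = q * (ia * ib * it) := fun p q h => by rw [h]
  have := e _ _ key
  generalize hP : (1 - v * a - v * t + v * a * t) = P at *
  generalize hQ : (1 - v * b - v * t + v * b * t) = Q at *
  generalize (1 - ε * a * (1 - x)) = A at *
  generalize (1 - ε * b * (1 - x)) = B at *
  generalize x ^ ε * (x - 1) = f at *
  generalize v ^ ε * (v - 1) = g at *
  linear_combination this - P * f * ia * it * hb + Q * f * ib * it * ha
    + g * (A * ia * ((1 - y * b) * ib) - B * ib * ((1 - y * a) * ia)) * ht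
    + g * A * ia * hb - g * B * ib * ha

/-- Both generating functions have `N - i` as smallest site; the one on the left has the additional
site `N`. Both sides satisfy the same recursion in `i`: on the right it is `tilingSum_succ`, whose
hypothesis `hf` is supplied by `exchange`. -/
theorem transfer_recursion {ε N : ℕ} (hε : ε ≤ 1)
    (hI : ∀ n i, 1 ≤ n → (1 - V n * X i) * I n i = 1)
    (hV : ∀ m n, 1 ≤ m → 1 ≤ n → V (m + n) * (V m + V n - 1) = V m * V n) (i : ℕ) (hi : i < N)
    (s t : ι) (w : List ι) :
    pairProd (V N) X (t :: w) * (1 - V (i + 1) * X s)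
        * transfer V X I ε (N + 1) (i + 1) (s :: t :: w)
      = tilingSum (V N ^ ε * (V N - 1)) (s :: t :: w) .none
          (fun o => pairProd (V N) X o * transfer V X I ε N i o) := by
  induction i generalizing s t w with
  | zero =>
    have hs := hI 1 s le_rfl
    have e0 : ∀ (s t : ι) w, transfer V X I ε N 0 (s :: t :: w) = 0 := fun _ _ _ => rfl
    have e0' : ∀ (s t : ι) w, transfer V X I ε (N + 1) 0 (s :: t :: w) = 0 := fun _ _ _ => rfl
    have e1 : ∀ (a : ι) w, transfer V X I ε N 0 (a :: w) = 0 := fun a w => by cases w <;> rfl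
    have e1' : ∀ (a : ι) w, transfer V X I ε (N + 1) 0 (a :: w) = 0 := fun a w => by
      cases w <;> rfl
    rw [transfer_succ, e0']
    -- With no sites only the empty remainder counts on the right, and among nonempty words only
    -- those of two letters can be deleted completely.
    rcases w with _ | ⟨a, _ | ⟨b, w⟩⟩
    · have ht := hI N t (by omega)
      simp only [tilingSum, e0, e1, pairProd, transfer_nil, zero_add, Nat.add_sub_cancel] at *
      linear_combination V N ^ ε * (V N - 1) * ((1 - V 1 * X s) * I 1 s * ht + hs)
    · simp [tilingSum, e1']
    · simp [tilingSum, e1, e1', tilingSum_zero]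
  | succ i ih =>
    have hx := hV (N - (i + 1)) (i + 1) (by omega) (by omega)
    rw [show N - (i + 1) + (i + 1) = N by omega] at hx
    set v := V N
    set c := v ^ ε * (v - 1) with hc
    have hy := hI (i + 1) s (by omega)
    have hy2 := hI (i + 2) s (by omega)
    have hsub : N + 1 - (i + 1 + 1) = N - (i + 1) := by omega
    have hxt := fun t => hI (N - (i + 1)) t (by omega)
    set x := V (N - (i + 1))
    set g : ι → S := fun s => (1 - ε * X s * (1 - x)) * I (i + 1) s with hg
    set f : ι → ι → S := fun s t => (1 - v * X s - v * X t + v * X s * X t) *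
      (x ^ ε * (x - 1) * I (N - (i + 1)) t * I (i + 1) s) with hfdef
    have hf : ∀ s s' t, f s t - f s' t = c * (g s - g s') := fun s s' t =>
      exchange hε hx (hI _ _ (by omega)) (hI _ _ (by omega)) (hxt t)
    have hG : ∀ s t o, pairProd v X (s :: t :: o) * transfer V X I ε N (i + 1) (s :: t :: o)
        = g s * (pairProd v X (s :: t :: o) * transfer V X I ε N i (s :: t :: o))
          + f s t * (pairProd v X o * transfer V X I ε N i o) := by
      intro s t o
      rw [transfer_succ, pairProd]
      simp only [hg, hfdef]
      ring
    -- At level `N + 1` the new site is again `N - (i + 1)`, at distance `i + 2` from the end.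
    -- Inserting `1 = (1 - V (i + 1) * X s) * I (i + 1) s` makes the factor `g s` of the right-hand
    -- side appear.
    have hL : (1 - V (i + 1 + 1) * X s) * transfer V X I ε (N + 1) (i + 1 + 1) (s :: t :: w)
        = g s * ((1 - V (i + 1) * X s) * transfer V X I ε (N + 1) (i + 1) (s :: t :: w))
          + x ^ ε * (x - 1) * I (N - (i + 1)) t * transfer V X I ε (N + 1) (i + 1) w := by
      rw [transfer_succ, hsub]
      simp only [hg]
      linear_combination
        ((1 - ε * X s * (1 - x)) * transfer V X I ε (N + 1) (i + 1) (s :: t :: w)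
          + x ^ ε * (x - 1) * I (N - (i + 1)) t * transfer V X I ε (N + 1) (i + 1) w) * hy2
        - (1 - ε * X s * (1 - x)) * transfer V X I ε (N + 1) (i + 1) (s :: t :: w) * hy
    have ih1 := ih (by omega) s t w
    rcases w with _ | ⟨a, _ | ⟨b, w⟩⟩
    · rw [tilingSum_succ_pair (g := g) (f := f)
        (G := fun o => pairProd v X o * transfer V X I ε N i o) hG
        (by simp [pairProd, transfer_nil]) (by simp [pairProd, transfer_nil]), ← ih1]
      -- The absent next pair is imitated by a letter with value `0`.
      have ex := exchange (b := 0) (ib := 1) hε hx (hI (i + 1) s (by omega)) (by ring) (hxt t)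
      rw [transfer_nil] at hL
      simp only [pairProd]
      simp only [hfdef, hg] at *
      linear_combination (1 - v * X t) * hL - ex
    · rw [transfer_singleton] at hL
      have e : ∀ G : List ι → S, tilingSum c [s, t, a] .none G = 0 := fun G => by
        simp [tilingSum]
      rw [e] at ih1 ⊢
      linear_combination pairProd v X [t, a] * hL + g s * ih1
    · rw [tilingSum_succ (g := g) (f := f)
        (G := fun o => pairProd v X o * transfer V X I ε N i o) hG
        (by simp [pairProd, transfer_nil]) hf, ← ih1, ← ih (by omega) a b w]
      have hya := hI (i + 1) a (by omega)
      simp only [pairProd, hfdef]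
      linear_combination (1 - v * X t - v * X a + v * X t * X a) * pairProd v X (b :: w) * hL
        - (1 - v * X t - v * X a + v * X t * X a) * pairProd v X (b :: w)
          * x ^ ε * (x - 1) * I (N - (i + 1)) t * transfer V X I ε (N + 1) (i + 1) (a :: b :: w)
          * hya

end Transfer

/-! ### Tilings as pairs of sets of dominoes -/

/-- The union of the dominoes `{2j, 2j+1}`, `j ∈ R`, and `{2j-1, 2j}`, `j ∈ R'`. -/
def covered (R R' : Finset ℕ) : Finset ℕ :=
  R.biUnion (fun j => {2 * j, 2 * j + 1}) ∪ R'.biUnion (fun j => {2 * j - 1, 2 * j})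

/-- The dominoes `{2j-1, 2j}`, `j ∈ R'`, have no neighbours among each other and do not meet the
dominoes `{2j, 2j+1}`, `j ∈ R`. -/
def Admissible (R R' : Finset ℕ) : Prop :=
  ∀ j ∈ R', j ∉ R ∧ (∀ i ∈ R, i + 1 ≠ j) ∧ j + 1 ∉ R'

instance (R R' : Finset ℕ) : Decidable (Admissible R R') := by
  unfold Admissible; infer_instance

theorem Admissible.mono {R R' T T' : Finset ℕ} (h : Admissible T T') (hR : R ⊆ T) (hR' : R' ⊆ T') :
    Admissible R R' := fun j hj =>
  ⟨fun hj' => (h j (hR' hj)).1 (hR hj'), fun i hi => (h j (hR' hj)).2.1 i (hR hi),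
    fun hj' => (h j (hR' hj)).2.2 (hR' hj')⟩

theorem even_mem_covered {R R' : Finset ℕ} {i : ℕ} (hi : 1 ≤ i) :
    2 * i ∈ covered R R' ↔ i ∈ R ∨ i ∈ R' := by
  simp only [covered, Finset.mem_union, Finset.mem_biUnion, Finset.mem_insert,
    Finset.mem_singleton]
  constructor
  · rintro (⟨j, hj, h⟩ | ⟨j, hj, h⟩)
    · obtain rfl : i = j := by omega
      exact .inl hj
    · obtain rfl : i = j := by omega
      exact .inr hj
  · rintro (h | h)
    · exact .inl ⟨i, h, .inl rfl⟩
    · exact .inr ⟨i, h, .inr rfl⟩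

theorem odd_mem_covered {R R' : Finset ℕ} {i : ℕ} (hi : 1 ≤ i) :
    2 * i - 1 ∈ covered R R' ↔ i - 1 ∈ R ∨ i ∈ R' := by
  simp only [covered, Finset.mem_union, Finset.mem_biUnion, Finset.mem_insert,
    Finset.mem_singleton]
  constructor
  · rintro (⟨j, hj, h⟩ | ⟨j, hj, h⟩)
    · obtain rfl : i - 1 = j := by omega
      exact .inl hj
    · obtain rfl : i = j := by omega
      exact .inr hj
  · rintro (h | h)
    · exact .inl ⟨i - 1, h, .inr (by omega)⟩
    · exact .inr ⟨i, h, .inl rfl⟩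

section

variable {S : Type*} [CommRing S]

/-- The sum over the admissible pairs that extend `(R₀, R₀')` by elements of `[i, i + n)`. -/
def extensionSum (c : S) (n i : ℕ) (R₀ R₀' : Finset ℕ) (G : List ℕ → S) : S :=
  ∑ R ∈ (Finset.Ico i (i + n)).powerset, ∑ R' ∈ (Finset.Ico i (i + n)).powerset,
    -- The last condition excludes an even-odd domino that would stick out of the word; for `n = 0`
    -- it matches the value `0` of `tilingSum` on the empty word in state `.eo`.
    if Admissible (R₀ ∪ R) (R₀' ∪ R') ∧ i + n - 1 ∉ R₀ ∪ R then
      (-1) ^ R.card * c ^ (R.card + R'.card)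
        * G ((List.range' (2 * i - 1) (2 * n)).filter (· ∉ covered (R₀ ∪ R) (R₀' ∪ R')))
    else 0

theorem extensionSum_eq_zero (c : S) (n i : ℕ) {R₀ R₀' : Finset ℕ} (G : List ℕ → S)
    (h : ¬ Admissible R₀ R₀') : extensionSum c n i R₀ R₀' G = 0 := by
  refine Finset.sum_eq_zero fun R _ => Finset.sum_eq_zero fun R' _ => if_neg fun h' => ?_
  exact h (h'.1.mono Finset.subset_union_left Finset.subset_union_left)

theorem range'_two_mul_succ {i : ℕ} (hi : 1 ≤ i) (n : ℕ) : List.range' (2 * i - 1) (2 * (n + 1))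
    = (2 * i - 1) :: (2 * i) :: List.range' (2 * (i + 1) - 1) (2 * n) := by
  rw [show 2 * (n + 1) = 2 * n + 1 + 1 by ring, List.range'_succ, List.range'_succ]
  congr 3 <;> omega

/-- Once the choices at `i` are frozen into `R₀` and `R₀'`, the fate of the letters `2 * i - 1` and
`2 * i` is settled, since it depends only on the dominoes numbered `i - 1` and `i`. -/
theorem extensionSum_branch (c : S) (n : ℕ) {i : ℕ} (hi : 1 ≤ i) (R₀ R₀' : Finset ℕ)
    (G : List ℕ → S) :
    (∑ R ∈ (Finset.Ico (i + 1) (i + 1 + n)).powerset,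
      ∑ R' ∈ (Finset.Ico (i + 1) (i + 1 + n)).powerset,
      if Admissible (R₀ ∪ R) (R₀' ∪ R') ∧ i + (n + 1) - 1 ∉ R₀ ∪ R then
        (-1) ^ R.card * c ^ (R.card + R'.card)
          * G ((List.range' (2 * i - 1) (2 * (n + 1))).filter
              (· ∉ covered (R₀ ∪ R) (R₀' ∪ R')))
      else 0)
    = extensionSum c n (i + 1) R₀ R₀' (fun o =>
        G ((if i - 1 ∈ R₀ ∨ i ∈ R₀' then [] else [2 * i - 1])
          ++ ((if i ∈ R₀ ∨ i ∈ R₀' then [] else [2 * i]) ++ o))) := by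
  refine Finset.sum_congr rfl fun R hR => Finset.sum_congr rfl fun R' hR' => ?_
  rw [Finset.mem_powerset] at hR hR'
  have h1 : i ∉ R := fun h => by have := Finset.mem_Ico.mp (hR h); omega
  have h2 : i ∉ R' := fun h => by have := Finset.mem_Ico.mp (hR' h); omega
  have h3 : i - 1 ∉ R := fun h => by have := Finset.mem_Ico.mp (hR h); omega
  rw [show i + (n + 1) - 1 = i + 1 + n - 1 by omega, range'_two_mul_succ hi]
  congr 3
  simp only [List.filter_cons, odd_mem_covered hi, even_mem_covered hi, Finset.mem_union, h1, h2,
    h3, or_false]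
  by_cases a : i ∈ R₀ <;> by_cases b : i ∈ R₀' <;> by_cases d : i - 1 ∈ R₀ <;> simp [a, b, d]

theorem extensionSum_succ (c : S) (n : ℕ) {i : ℕ} (hi : 1 ≤ i) (R₀ R₀' : Finset ℕ)
    (G : List ℕ → S) (H : Finset ℕ → Finset ℕ → List ℕ → S)
    (hH : ∀ R R', H R R' = fun o => G ((if i - 1 ∈ R ∨ i ∈ R' then [] else [2 * i - 1])
          ++ ((if i ∈ R ∨ i ∈ R' then [] else [2 * i]) ++ o))) :
    extensionSum c (n + 1) i R₀ R₀' G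
      = extensionSum c n (i + 1) R₀ R₀' (H R₀ R₀')
        + c * extensionSum c n (i + 1) R₀ (insert i R₀') (H R₀ (insert i R₀'))
        - c * (extensionSum c n (i + 1) (insert i R₀) R₀' (H (insert i R₀) R₀')
          + c * extensionSum c n (i + 1) (insert i R₀) (insert i R₀')
              (H (insert i R₀) (insert i R₀'))) := by
  have hIco : Finset.Ico i (i + (n + 1)) = insert i (Finset.Ico (i + 1) (i + 1 + n)) := by
    ext; simp only [Finset.mem_Ico, Finset.mem_insert]; omega
  have hni : i ∉ Finset.Ico (i + 1) (i + 1 + n) := by simp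
  have hc : ∀ R ∈ (Finset.Ico (i + 1) (i + 1 + n)).powerset, (insert i R).card = R.card + 1 :=
    fun R hR => Finset.card_insert_of_notMem fun h => hni (Finset.mem_powerset.mp hR h)
  simp only [hH, ← extensionSum_branch c n hi]
  rw [extensionSum, hIco, Finset.sum_powerset_insert hni]
  simp only [Finset.sum_powerset_insert hni, Finset.sum_add_distrib, mul_add, Finset.mul_sum]
  rw [sub_eq_add_neg, neg_add, ← Finset.sum_neg_distrib, ← Finset.sum_neg_distrib]
  simp only [← Finset.sum_neg_distrib]
  refine congrArg₂ (· + ·) (congrArg₂ (· + ·) rfl ?_) (congrArg₂ (· + ·) ?_ ?_)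
  · refine Finset.sum_congr rfl fun R hR => Finset.sum_congr rfl fun R' hR' => ?_
    rw [hc R' hR', Finset.union_insert, Finset.insert_union]
    split_ifs <;> ring
  · refine Finset.sum_congr rfl fun R hR => Finset.sum_congr rfl fun R' hR' => ?_
    rw [hc R hR, Finset.union_insert, Finset.insert_union]
    split_ifs <;> ring
  · refine Finset.sum_congr rfl fun R hR => Finset.sum_congr rfl fun R' hR' => ?_
    rw [hc R hR, hc R' hR', Finset.union_insert, Finset.insert_union, Finset.union_insert,
      Finset.insert_union]
    split_ifs <;> ring

/-- The effect of `(R, R')` on the pair number `i`. -/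
def gapAt (i : ℕ) (R R' : Finset ℕ) : Gap :=
  if i - 1 ∈ R then .eo else if i - 1 ∈ R' then .oe else .none

/-- Admissibility at `i` involves, of the earlier choices, only those at `i - 1`, so the state
`gapAt` retains all that matters. Of the four choices at `i`, taking both dominoes is never
admissible. -/
theorem extensionSum_eq_tilingSum (c : S) (n : ℕ) : ∀ (i : ℕ), 1 ≤ i → ∀ (R R' : Finset ℕ),
    (∀ j ∈ R, j < i) → (∀ j ∈ R', j < i) → Admissible R R' → ∀ G : List ℕ → S,
    extensionSum c n i R R' G
      = tilingSum c (List.range' (2 * i - 1) (2 * n)) (gapAt i R R') G := by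
  induction n with
  | zero =>
    intro i hi R R' _ _ h G
    simp only [extensionSum, gapAt, add_zero, Finset.Ico_self, Finset.powerset_empty,
      Finset.sum_singleton, Finset.union_empty, h, true_and, mul_zero, List.range'_zero,
      List.filter_nil, Finset.card_empty, pow_zero, one_mul]
    split_ifs <;> rfl
  | succ n ih =>
    intro i hi R R' hR hR' h G
    have n1 : i ∉ R := fun h => (hR i h).false
    have n2 : i ∉ R' := fun h => (hR' i h).false
    rw [extensionSum_succ c n hi R R' G _ fun _ _ => rfl, range'_two_mul_succ hi]
    have lt : ∀ T : Finset ℕ, (∀ j ∈ T, j < i) → ∀ j ∈ T, j < i + 1 := fun T hT j hj =>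
      (hT j hj).trans (Nat.lt_succ_self i)
    have lt' : ∀ T : Finset ℕ, (∀ j ∈ T, j < i) → ∀ j ∈ insert i T, j < i + 1 := by
      intro T hT j hj
      rcases Finset.mem_insert.mp hj with rfl | hj
      · exact Nat.lt_succ_self j
      · exact lt T hT j hj
    have both : ¬ Admissible (insert i R) (insert i R') := fun h =>
      (h i (Finset.mem_insert_self _ _)).1 (Finset.mem_insert_self _ _)
    have eo : Admissible (insert i R) R' := by
      intro j hj
      have hlt := hR' j hj
      refine ⟨?_, ?_, (h j hj).2.2⟩
      · rw [Finset.mem_insert]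
        rintro (rfl | h')
        · exact n2 hj
        · exact (h j hj).1 h'
      · intro k hk
        rcases Finset.mem_insert.mp hk with rfl | hk
        · omega
        · exact (h j hj).2.1 k hk
    rw [extensionSum_eq_zero _ _ _ _ both, ih (i + 1) (by omega) _ _ (lt _ hR) (lt _ hR') h,
      ih (i + 1) (by omega) _ _ (lt' _ hR) (lt _ hR') eo]
    have g0 : gapAt (i + 1) R R' = .none := by simp [gapAt, n1, n2]
    have g1 : gapAt (i + 1) (insert i R) R' = .eo := by simp [gapAt]
    rw [g0, g1]
    have ne : i - 1 ≠ i := by omega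
    by_cases h1 : i - 1 ∈ R
    · have no : ¬ Admissible R (insert i R') := fun h =>
        (h i (Finset.mem_insert_self _ _)).2.1 (i - 1) h1 (by omega)
      rw [extensionSum_eq_zero _ _ _ _ no]
      simp [gapAt, h1, n1, n2, tilingSum]
    · by_cases h2 : i - 1 ∈ R'
      · have no : ¬ Admissible R (insert i R') := fun h =>
          (h (i - 1) (Finset.mem_insert_of_mem h2)).2.2
            (by rw [show i - 1 + 1 = i by omega]; exact Finset.mem_insert_self _ _)
        rw [extensionSum_eq_zero _ _ _ _ no]
        simp [gapAt, h1, h2, n1, n2, ne, tilingSum]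
      · have oe : Admissible R (insert i R') := by
          intro j hj
          rcases Finset.mem_insert.mp hj with rfl | hj
          · refine ⟨n1, ?_, ?_⟩
            · rintro k hk rfl
              exact h1 (by simpa using hk)
            · rw [Finset.mem_insert]
              rintro (h' | h')
              · omega
              · have := hR' _ h'; omega
          · refine ⟨(h j hj).1, (h j hj).2.1, ?_⟩
            rw [Finset.mem_insert]
            rintro (h' | h')
            · exact h2 (by rwa [← h', Nat.add_sub_cancel])
            · exact (h j hj).2.2 h'
        have g2 : gapAt (i + 1) R (insert i R') = .oe := by simp [gapAt, n1]
        rw [ih (i + 1) (by omega) _ _ (lt _ hR) (lt' _ hR') oe, g2]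
        simp [gapAt, h1, h2, n1, n2, ne, tilingSum]
        ring

/-! ### The members of `𝒯(r)` -/

/-- If `2 * j` and `2 * j + 1` were covered without the domino `j` of `R`, they would belong to the
odd-even dominoes `j` and `j + 1`, which may not both occur. Hence `eo` counts `R`, and the union
determines both families. -/
theorem mem_iff_covered_left {R R' : Finset ℕ} (h : Admissible R R') {j : ℕ} (hj : 1 ≤ j) :
    {2 * j, 2 * j + 1} ⊆ covered R R' ↔ j ∈ R := by
  have e : 2 * j + 1 = 2 * (j + 1) - 1 := by omega
  rw [Finset.insert_subset_iff, Finset.singleton_subset_iff, e, even_mem_covered hj,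
    odd_mem_covered (by omega), Nat.add_sub_cancel]
  constructor
  · rintro ⟨h1 | h1, h2 | h2⟩
    · exact h1
    · exact h1
    · exact h2
    · exact ((h j h1).2.2 h2).elim
  · exact fun h => ⟨.inl h, .inl h⟩

theorem eo_covered {R R' : Finset ℕ} (h : Admissible R R') (hR : ∀ j ∈ R, 1 ≤ j) :
    eo (covered R R') = R.card := by
  rw [eo]
  congr 1
  ext j
  rw [Finset.mem_filter, Finset.mem_Icc]
  constructor
  · rintro ⟨⟨h1, -⟩, h2⟩
    exact (mem_iff_covered_left h h1).mp h2
  · intro hj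
    have h2 := (mem_iff_covered_left h (hR j hj)).mpr hj
    refine ⟨⟨hR j hj, ?_⟩, h2⟩
    have : 2 * j ≤ (covered R R').sup id :=
      Finset.le_sup (f := id) (h2 (Finset.mem_insert_self _ _))
    omega

theorem card_covered {R R' : Finset ℕ} (h : Admissible R R') (hR' : ∀ j ∈ R', 1 ≤ j) :
    (covered R R').card = 2 * (R.card + R'.card) := by
  rw [covered, Finset.card_union_of_disjoint, Finset.card_biUnion, Finset.card_biUnion]
  · have h1 : ∀ j ∈ R, ({2 * j, 2 * j + 1} : Finset ℕ).card = 2 := fun j _ =>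
      Finset.card_pair (by omega)
    have h2 : ∀ j ∈ R', ({2 * j - 1, 2 * j} : Finset ℕ).card = 2 := fun j hj =>
      Finset.card_pair (by have := hR' j hj; omega)
    rw [Finset.sum_congr rfl h1, Finset.sum_congr rfl h2]
    simp
    ring
  · intro i hi j hj hij
    have := hR' i hi
    have := hR' j hj
    simp only [Function.onFun, Finset.disjoint_left, Finset.mem_insert, Finset.mem_singleton]
    omega
  · intro i hi j hj hij
    simp only [Function.onFun, Finset.disjoint_left, Finset.mem_insert, Finset.mem_singleton]
    omega
  · rw [Finset.disjoint_left]
    simp only [Finset.mem_biUnion, Finset.mem_insert, Finset.mem_singleton]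
    rintro a ⟨i, hi, hai⟩ ⟨j, hj, haj⟩
    have h1 := (h j hj).2.1 i hi
    have h2 : i ≠ j := fun e => (h j hj).1 (e ▸ hi)
    have := hR' j hj
    omega

theorem kappa_covered {R R' : Finset ℕ} (h : Admissible R R') (hR' : ∀ j ∈ R', 1 ≤ j) :
    kappa (covered R R') = R.card + R'.card := by
  rw [kappa, card_covered h hR']
  omega

theorem covered_injective {R R' T T' : Finset ℕ} (h : Admissible R R') (h' : Admissible T T')
    (hR : ∀ j ∈ R, 1 ≤ j) (hR' : ∀ j ∈ R', 1 ≤ j) (hT : ∀ j ∈ T, 1 ≤ j) (hT' : ∀ j ∈ T', 1 ≤ j)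
    (e : covered R R' = covered T T') : R = T ∧ R' = T' := by
  have e1 : R = T := by
    ext j
    by_cases hj : 1 ≤ j
    · rw [← mem_iff_covered_left h hj, e, mem_iff_covered_left h' hj]
    · exact ⟨fun h => (hj (hR j h)).elim, fun h => (hj (hT j h)).elim⟩
  refine ⟨e1, ?_⟩
  ext j
  by_cases hj : 1 ≤ j
  · have h1 : 2 * j ∈ covered R R' ↔ 2 * j ∈ covered T T' := by rw [e]
    rw [even_mem_covered hj, even_mem_covered hj, ← e1] at h1
    constructor
    · intro h2
      exact (h1.mp (.inr h2)).resolve_left (h j h2).1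
    · intro h2
      exact (h1.mpr (.inr h2)).resolve_left (e1 ▸ (h' j h2).1)
  · exact ⟨fun h => (hj (hR' j h)).elim, fun h => (hj (hT' j h)).elim⟩

theorem mem_Til {r : ℕ} {A : Finset ℕ} : A ∈ Til r ↔ ∃ R R', R ⊆ Finset.Icc 1 (r - 1) ∧
    R' ⊆ Finset.Icc 1 r ∧ Admissible R R' ∧ covered R R' = A := by
  simp only [Til, Finset.mem_image, Finset.mem_filter, Finset.mem_product, EO, OEstar, OE,
    Finset.mem_powerset, Prod.exists]
  constructor
  · rintro ⟨_, _, ⟨⟨⟨R, hR, rfl⟩, ⟨R', hR', rfl⟩, hs⟩, hd⟩, rfl⟩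
    refine ⟨R, R', hR, hR', fun j hj => ⟨fun h => ?_, ?_, fun h => ?_⟩, rfl⟩
    · exact Finset.disjoint_left.mp hd
        (show 2 * j ∈ _ from Finset.mem_biUnion.mpr ⟨j, h, by simp⟩)
        (Finset.mem_biUnion.mpr ⟨j, hj, by simp⟩)
    · rintro i hi rfl
      exact Finset.disjoint_left.mp hd
        (show 2 * i + 1 ∈ _ from Finset.mem_biUnion.mpr ⟨i, hi, by simp⟩)
        (Finset.mem_biUnion.mpr ⟨i + 1, hj, by simp; omega⟩)
    · exact hs (2 * (j + 1)) (Finset.mem_biUnion.mpr ⟨j + 1, h, by simp⟩) (2 * j)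
        (Finset.mem_biUnion.mpr ⟨j, hj, by simp⟩) (by ring)
  · rintro ⟨R, R', hR, hR', h, rfl⟩
    refine ⟨_, _, ⟨⟨⟨R, hR, rfl⟩, ⟨R', hR', rfl⟩, ?_⟩, ?_⟩, rfl⟩
    · simp only [Finset.mem_biUnion, Finset.mem_insert, Finset.mem_singleton]
      rintro a ⟨i, hi, hai⟩ b ⟨j, hj, hbj⟩ hab
      have h1 := Finset.mem_Icc.mp (hR' hi)
      have h2 := Finset.mem_Icc.mp (hR' hj)
      obtain rfl : i = j + 1 := by omega
      exact (h j hj).2.2 hi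
    · rw [Finset.disjoint_left]
      simp only [Finset.mem_biUnion, Finset.mem_insert, Finset.mem_singleton]
      rintro a ⟨i, hi, hai⟩ ⟨j, hj, haj⟩
      have h1 := (h j hj).2.1 i hi
      have h2 : i ≠ j := fun e => (h j hj).1 (e ▸ hi)
      have h3 := Finset.mem_Icc.mp (hR' hj)
      omega

theorem Til_subset {r : ℕ} {A : Finset ℕ} (hA : A ∈ Til r) : A ⊆ Finset.Icc 1 (2 * r) := by
  obtain ⟨R, R', hR, hR', -, rfl⟩ := mem_Til.mp hA
  intro a
  simp only [covered, Finset.mem_union, Finset.mem_biUnion, Finset.mem_insert,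
    Finset.mem_singleton]
  rintro (⟨j, hj, h⟩ | ⟨j, hj, h⟩)
  · have := Finset.mem_Icc.mp (hR hj)
    rw [Finset.mem_Icc]
    omega
  · have := Finset.mem_Icc.mp (hR' hj)
    rw [Finset.mem_Icc]
    omega

theorem even_card_of_mem_Til {r : ℕ} {A : Finset ℕ} (hA : A ∈ Til r) : Even A.card := by
  obtain ⟨R, R', hR, hR', h, rfl⟩ := mem_Til.mp hA
  rw [card_covered h fun j hj => (Finset.mem_Icc.mp (hR' hj)).1]
  exact even_two_mul _

theorem empty_mem_Til (r : ℕ) : ∅ ∈ Til r :=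
  mem_Til.mpr ⟨∅, ∅, by simp, by simp, by simp [Admissible], rfl⟩

/-- The decomposition into dominoes is unique, so a sum over `𝒯(r)` is a sum over admissible pairs,
with `eo` and `kappa` becoming cardinalities. -/
theorem sum_Til (c : S) (r : ℕ) (G : List ℕ → S) :
    ∑ A ∈ Til r, (-1) ^ eo A * c ^ kappa A * G ((List.range' 1 (2 * r)).filter (· ∉ A))
      = tilingSum c (List.range' 1 (2 * r)) .none G := by
  have h0 := extensionSum_eq_tilingSum c r 1 le_rfl ∅ ∅ (by simp) (by simp)
    (by simp [Admissible]) G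
  rw [show gapAt 1 ∅ ∅ = .none by simp [gapAt], show 2 * 1 - 1 = 1 from rfl] at h0
  rw [← h0, extensionSum, ← Finset.sum_product', ← Finset.sum_filter]
  symm
  refine Finset.sum_nbij (fun P => covered P.1 P.2) ?_ ?_ ?_ ?_
  · intro P hP
    simp only [Finset.mem_filter, Finset.mem_product, Finset.mem_powerset, Finset.empty_union]
      at hP
    obtain ⟨⟨h1, h2⟩, h3, h4⟩ := hP
    refine mem_Til.mpr ⟨P.1, P.2, ?_, ?_, h3, rfl⟩
    · intro j hj
      have := Finset.mem_Ico.mp (h1 hj)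
      have : j ≠ 1 + r - 1 := fun e => h4 (e ▸ hj)
      rw [Finset.mem_Icc]
      omega
    · intro j hj
      have := Finset.mem_Ico.mp (h2 hj)
      rw [Finset.mem_Icc]
      omega
  · intro P hP Q hQ e
    simp only [Finset.coe_filter, Finset.mem_product, Finset.mem_powerset, Finset.empty_union,
      Set.mem_ofPred_eq] at hP hQ
    have p : ∀ T ⊆ Finset.Ico 1 (1 + r), ∀ j ∈ T, 1 ≤ j := fun T hT j hj =>
      (Finset.mem_Ico.mp (hT hj)).1
    have := covered_injective hP.2.1 hQ.2.1 (p _ hP.1.1) (p _ hP.1.2) (p _ hQ.1.1) (p _ hQ.1.2) e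
    exact Prod.ext this.1 this.2
  · intro A hA
    obtain ⟨R, R', hR, hR', h, rfl⟩ := mem_Til.mp hA
    refine ⟨(R, R'), ?_, rfl⟩
    simp only [Finset.coe_filter, Finset.mem_product, Finset.mem_powerset, Finset.empty_union,
      Set.mem_ofPred_eq]
    refine ⟨⟨fun j hj => ?_, fun j hj => ?_⟩, h, fun hj => ?_⟩
    · have := Finset.mem_Icc.mp (hR hj)
      rw [Finset.mem_Ico]
      omega
    · have := Finset.mem_Icc.mp (hR' hj)
      rw [Finset.mem_Ico]
      omega
    · have := Finset.mem_Icc.mp (hR hj)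
      omega
  · intro P hP
    simp only [Finset.mem_filter, Finset.mem_product, Finset.mem_powerset, Finset.empty_union]
      at hP
    have p : ∀ T ⊆ Finset.Ico 1 (1 + r), ∀ j ∈ T, 1 ≤ j := fun T hT j hj =>
      (Finset.mem_Ico.mp (hT hj)).1
    rw [eo_covered hP.2.1 (p _ hP.1.1), kappa_covered hP.2.1 (p _ hP.1.2)]
    simp

/-! ### Expanding products over blocks -/

/-- The sum over `B ⊆ P` of `∏_{b ∈ B} (-X b)`, weighted by a power of `v` whose exponent is the
number of fibres of `φ` that `B` meets. -/
def fibreSum (v : S) (X : ℕ → S) (φ : ℕ → ℕ) (P : Finset ℕ) : S :=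
  ∑ B ∈ P.powerset, (-1) ^ B.card * v ^ (B.image φ).card * ∏ b ∈ B, X b

theorem fibreSum_congr (v : S) (X : ℕ → S) {φ ψ : ℕ → ℕ} {P : Finset ℕ}
    (h : ∀ a ∈ P, φ a = ψ a) : fibreSum v X φ P = fibreSum v X ψ P :=
  Finset.sum_congr rfl fun B hB => by
    rw [Finset.image_congr fun a ha => h a (Finset.mem_powerset.mp hB ha)]

theorem fibreSum_insert_one (v : S) (X : ℕ → S) (φ : ℕ → ℕ) {P : Finset ℕ} {a : ℕ}
    (hP : ∀ b ∈ P, φ b ≠ φ a) :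
    fibreSum v X φ (insert a P) = (1 - v * X a) * fibreSum v X φ P := by
  have ha : a ∉ P := fun h => hP a h rfl
  rw [fibreSum, Finset.sum_powerset_insert ha, sub_mul, one_mul, sub_eq_add_neg]
  congr 1
  rw [fibreSum, Finset.mul_sum, ← Finset.sum_neg_distrib]
  refine Finset.sum_congr rfl fun B hB => ?_
  rw [Finset.mem_powerset] at hB
  rw [Finset.card_insert_of_notMem fun h => ha (hB h), Finset.image_insert,
    Finset.card_insert_of_notMem, Finset.prod_insert fun h => ha (hB h)]
  · ring
  · rw [Finset.mem_image]
    rintro ⟨b, hb, e⟩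
    exact hP b (hB hb) e

theorem fibreSum_insert_two (v : S) (X : ℕ → S) (φ : ℕ → ℕ) {P : Finset ℕ} {a b : ℕ}
    (hab : a ≠ b) (e : φ b = φ a) (hP : ∀ d ∈ P, φ d ≠ φ a) :
    fibreSum v X φ (insert a (insert b P))
      = (1 - v * X a - v * X b + v * X a * X b) * fibreSum v X φ P := by
  have ha : a ∉ insert b P := by
    rw [Finset.mem_insert]
    rintro (h | h)
    · exact hab h
    · exact hP a h rfl
  have hb : b ∉ P := fun h => hP b h e
  rw [fibreSum, Finset.sum_powerset_insert ha, Finset.sum_powerset_insert hb,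
    Finset.sum_powerset_insert hb]
  simp only [fibreSum, Finset.mul_sum, ← Finset.sum_add_distrib]
  refine Finset.sum_congr rfl fun B hB => ?_
  rw [Finset.mem_powerset] at hB
  have h1 : a ∉ B := fun h => ha (Finset.mem_insert_of_mem (hB h))
  have h2 : b ∉ B := fun h => hb (hB h)
  have h3 : a ∉ insert b B := fun h => ha (Finset.insert_subset_insert _ hB h)
  have h4 : φ a ∉ B.image φ := by
    rw [Finset.mem_image]
    rintro ⟨d, hd, e⟩
    exact hP d (hB hd) e
  rw [Finset.card_insert_of_notMem h3, Finset.card_insert_of_notMem h2,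
    Finset.card_insert_of_notMem h1, Finset.prod_insert h3, Finset.prod_insert h2,
    Finset.prod_insert h1]
  simp only [Finset.image_insert, e, Finset.insert_idem]
  rw [Finset.card_insert_of_notMem h4]
  ring

/-- In `1 - v * X a - v * X b + v * X a * X b` the factor `v` occurs once however many of the two
letters are chosen, so its exponent counts the blocks met. The map `τ` numbers the letters
consecutively from an odd number, so that blocks are fibres of `(τ b + 1) / 2`. -/
theorem pairProd_eq_fibreSum (v : S) (X : ℕ → S) (τ : ℕ → ℕ) : ∀ (L : List ℕ) (k : ℕ),
    L.map τ = List.range' (2 * k + 1) L.length →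
    pairProd v X L = fibreSum v X (fun b => (τ b + 1) / 2) L.toFinset
  | [], _, _ => by simp [pairProd, fibreSum]
  | [a], _, _ => by
    rw [List.toFinset_cons, List.toFinset_nil, fibreSum_insert_one _ _ _ (by simp)]
    simp [pairProd, fibreSum]
  | a :: b :: L, k, h => by
    simp only [List.map_cons, List.length_cons, List.range'_succ, List.cons.injEq] at h
    obtain ⟨ha, hb, hL⟩ := h
    rw [pairProd, pairProd_eq_fibreSum v X τ L (k + 1) hL, List.toFinset_cons,
      List.toFinset_cons, fibreSum_insert_two]
    · rintro rfl
      omega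
    · omega
    · intro d hd
      have : τ d ∈ L.map τ := List.mem_map_of_mem (List.mem_toFinset.mp hd)
      rw [hL, List.mem_range'_1] at this
      omega

/-- The surviving letters are numbered consecutively by `sigma A`; pairing them in the shortened
word therefore gives the blocks counted by `betaRel`. -/
theorem map_sigma_filter (A : Finset ℕ) (n s : ℕ) :
    ((List.range' (s + 1) n).filter (· ∉ A)).map (sigma A)
      = List.range' (sigma A s + 1) ((List.range' (s + 1) n).filter (· ∉ A)).length := by
  induction n generalizing s with
  | zero => rfl
  | succ n ih =>
    have hs : sigma A (s + 1) = sigma A s + if s + 1 ∈ A then 0 else 1 := by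
      have : Finset.Icc 1 (s + 1) = insert (s + 1) (Finset.Icc 1 s) := by
        ext; simp only [Finset.mem_Icc, Finset.mem_insert]; omega
      rw [sigma, this]
      split_ifs with h
      · rw [Finset.insert_sdiff_of_mem _ h]; rfl
      · rw [Finset.insert_sdiff_of_notMem _ h, Finset.card_insert_of_notMem (by simp)]; rfl
    have := ih (s + 1)
    rw [List.range'_succ, List.filter_cons]
    by_cases h : s + 1 ∈ A
    · simp only [h, if_true, add_zero] at hs
      simpa [h, hs] using this
    · simp only [h, if_false] at hs
      simp only [h, not_false_eq_true, decide_true, if_true, List.map_cons, List.length_cons,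
        List.range'_succ, this, hs]

theorem toFinset_filter_range' (A : Finset ℕ) (n : ℕ) :
    ((List.range' 1 n).filter (· ∉ A)).toFinset = Finset.Icc 1 n \ A := by
  ext a
  simp only [List.mem_toFinset, List.mem_filter, List.mem_range'_1, Finset.mem_sdiff,
    Finset.mem_Icc, decide_eq_true_eq, show a < 1 + n ↔ a ≤ n by omega]

theorem pairProd_filter (v : S) (X : ℕ → S) (A : Finset ℕ) (n : ℕ) :
    pairProd v X ((List.range' 1 n).filter (· ∉ A))
      = ∑ B ∈ (Finset.Icc 1 n \ A).powerset,
          (-1) ^ B.card * v ^ betaRel A B * ∏ b ∈ B, X b := by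
  have h := map_sigma_filter A n 0
  rw [show sigma A 0 = 0 by simp [sigma]] at h
  rw [pairProd_eq_fibreSum v X (sigma A) _ 0 (by simpa using h), fibreSum]
  rw [toFinset_filter_range']
  refine Finset.sum_congr rfl fun B _ => ?_
  rw [betaRel, beta, Finset.image_image]
  rfl

/-- Starting at `2` shifts the pairing to `{2, 3}, {4, 5}, …`, and the extra factor accounts for `1`
in the block `{0, 1}`: these are the blocks of `alpha`. -/
theorem pairProd_tail (v : S) (X : ℕ → S) (n : ℕ) :
    pairProd v X (List.range' 2 n) * (1 - v * X 1)
      = ∑ B ∈ (Finset.Icc 1 (n + 1)).powerset,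
          (-1) ^ B.card * v ^ alpha B * ∏ b ∈ B, X b := by
  have e : Finset.Icc 1 (n + 1) = insert 1 (List.range' 2 n).toFinset := by
    ext a
    simp only [List.mem_toFinset, List.mem_range'_1, Finset.mem_insert, Finset.mem_Icc]
    omega
  have h : (List.range' 2 n).map (fun b => b - 1) = List.range' (2 * 0 + 1) n := by
    rw [List.map_sub_range' (by norm_num)]
  rw [pairProd_eq_fibreSum v X (fun b => b - 1) _ 0 (by simpa using h), e, mul_comm,
    fibreSum_congr (ψ := fun b => b / 2), ← fibreSum_insert_one]
  · rfl
  · intro b hb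
    rw [List.mem_toFinset, List.mem_range'_1] at hb
    omega
  · intro b hb
    rw [List.mem_toFinset, List.mem_range'_1] at hb
    have : b - 1 + 1 = b := by omega
    rw [this]

end

/-! ### Extracting coefficients -/

section Coefficients

open MvPowerSeries

variable {R : Type*} [CommRing R]

theorem coeff_one_sub_mul (a : R) (s : ℕ) (d : ℕ →₀ ℕ) (f : MvPowerSeries ℕ R) :
    coeff d ((1 - C a * X s) * f)
      = coeff d f - a * if 1 ≤ d s then coeff (d - Finsupp.single s 1) f else 0 := by
  rw [sub_mul, one_mul, map_sub, mul_assoc, coeff_C_mul, X_def, coeff_monomial_mul]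
  simp [Finsupp.single_le_iff]

/-- The series `1 / (1 - a X_s)`. -/
noncomputable def geomSeries (a : R) (s : ℕ) : MvPowerSeries ℕ R :=
  invOfUnit (1 - C a * X s) 1

theorem mul_geomSeries (a : R) (s : ℕ) : (1 - C a * X s) * geomSeries a s = 1 :=
  mul_invOfUnit _ _ (by simp)

theorem coeff_geomSeries_mul (a : R) (s : ℕ) {f : MvPowerSeries ℕ R}
    (hf : ∀ d : ℕ →₀ ℕ, d s ≠ 0 → coeff d f = 0) (n : ℕ) : ∀ d : ℕ →₀ ℕ, d s = n →
    coeff d (geomSeries a s * f) = a ^ n * coeff (d.erase s) f := by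
  have h : (1 - C a * X s) * (geomSeries a s * f) = f := by
    rw [← mul_assoc, mul_geomSeries, one_mul]
  have h' := fun d => congrArg (coeff d) h
  simp only [coeff_one_sub_mul] at h'
  induction n with
  | zero =>
    intro d hd
    have := h' d
    rw [hd, if_neg (by omega), mul_zero, sub_zero] at this
    rw [this, Finsupp.erase_of_notMem_support (by simpa using hd)]
    simp
  | succ n ih =>
    intro d hd
    have := h' d
    rw [hf d (by omega), if_pos (by omega), ih (d - Finsupp.single s 1) (by simp [hd])] at this
    have e : (d - Finsupp.single s 1).erase s = d.erase s := by
      ext i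
      by_cases hi : i = s
      · simp [hi]
      · simp [Finsupp.erase_ne hi, Ne.symm hi]
    rw [e] at this
    rw [pow_succ']
    linear_combination this

/-- The recursion satisfied by truncated sums indexed by sequences of even length, in the number
`j` of sites `N - j, …, N - 1` that are summed over. -/
structure IsTruncated (v : ℕ → R) (ε N : ℕ) (f : ℕ → List ℕ → R) : Prop where
  nil : ∀ j, f j [] = 1
  zero : ∀ a b c, f 0 (a :: b :: c) = 0
  one : ∀ j k c, j + 1 < N → f (j + 1) (1 :: (k + 1) :: c) = f j (1 :: (k + 1) :: c)
    + v (N - (j + 1)) ^ ε * (v (N - (j + 1)) - 1) * v (N - (j + 1)) ^ k * f j c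
  succ : ∀ j l k c, j + 1 < N → f (j + 1) ((l + 2) :: (k + 1) :: c)
    = v (j + 1) * f (j + 1) ((l + 1) :: (k + 1) :: c) + f j ((l + 2) :: (k + 1) :: c)
      - ε * (1 - v (N - (j + 1))) * f j ((l + 1) :: (k + 1) :: c)

/-- The generating function of truncated sums in the ring of power series. -/
noncomputable def genFun (v : ℕ → R) (ε N j : ℕ) (L : List ℕ) : MvPowerSeries ℕ R :=
  transfer (fun n => C (v n)) X (fun n => geomSeries (v n)) ε N j L

/-- Multiplied by `1 - v (j + 1) * X s`, the transfer recursion relates finitely many coefficients.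
Exponent zero at `s` gives the rule `one` of `IsTruncated`, positive exponent the rule `succ`. -/
theorem coeff_genFun {v : ℕ → R} {ε N : ℕ} {f : ℕ → List ℕ → R} (hf : IsTruncated v ε N f)
    (j : ℕ) (hj : j < N) : ∀ (L : List ℕ), L.Nodup → Even L.length → ∀ d : ℕ →₀ ℕ,
    coeff d (genFun v ε N j L)
      = if d.support ⊆ L.toFinset then f j (L.map fun i => d i + 1) else 0 := by
  have hnil : ∀ (j : ℕ) (d : ℕ →₀ ℕ), coeff d (genFun v ε N j [])
      = if d.support ⊆ ([] : List ℕ).toFinset then f j [] else 0 := by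
    intro j d
    rw [genFun, transfer_nil, coeff_one, hf.nil]
    simp
  induction j with
  | zero =>
    rintro (_ | ⟨s, _ | ⟨t, L⟩⟩) - hL d
    · exact hnil 0 d
    · simp at hL
    · have : genFun v ε N 0 (s :: t :: L) = 0 := rfl
      rw [this]
      simp [hf.zero]
  | succ j ih =>
    rintro (_ | ⟨s, _ | ⟨t, L⟩⟩) hnd hL d
    · exact hnil _ d
    · simp at hL
    have ih1 := ih (by omega) _ hnd hL
    have hL' : Even L.length := by
      simpa [Nat.even_add_one] using hL
    have ih2 := ih (by omega) L hnd.of_cons.of_cons hL'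
    have hst : s ≠ t := fun e => by simp [e] at hnd
    have hsL : s ∉ L := fun e => by simp [e] at hnd
    have htL : t ∉ L := fun e => by simp [e] at hnd
    set x := v (N - (j + 1)) with hx
    have hrec : (1 - C (v (j + 1)) * X s) * genFun v ε N (j + 1) (s :: t :: L)
        = (1 - C (ε * (1 - x)) * X s) * genFun v ε N j (s :: t :: L)
          + C (x ^ ε * (x - 1)) * (geomSeries x t * genFun v ε N j L) := by
      have := mul_geomSeries (v (j + 1)) s
      simp only [genFun]
      rw [transfer_succ, ← hx]
      push_cast [map_mul, map_sub, map_pow, map_one, map_natCast]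
      linear_combination (((1 - ε * X s * (1 - C x))
        * transfer (fun n => C (v n)) X (fun n => geomSeries (v n)) ε N j (s :: t :: L)
        + C x ^ ε * (C x - 1) * geomSeries x t
          * transfer (fun n => C (v n)) X (fun n => geomSeries (v n)) ε N j L)) * this
    have hgeom := coeff_geomSeries_mul x t (f := genFun v ε N j L) fun d hd => by
      rw [ih2 d, if_neg]
      intro h
      exact htL (by simpa using h (Finsupp.mem_support_iff.mpr hd))
    have hcoef := fun d => congrArg (coeff d) hrec
    simp only [map_add, coeff_one_sub_mul, coeff_C_mul, hgeom _ _ rfl] at hcoef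
    induction hn : d s generalizing d with
    | zero =>
      have h := hcoef d
      rw [hn, if_neg (by omega), if_neg (by omega), mul_zero, sub_zero, mul_zero, sub_zero, ih1,
        ih2] at h
      rw [h]
      have e : (d.erase t).support ⊆ L.toFinset ↔ d.support ⊆ (s :: t :: L).toFinset := by
        rw [Finsupp.support_erase, List.toFinset_cons, List.toFinset_cons]
        constructor
        · intro h i hi
          by_cases hit : i = t
          · simp [hit]
          · have := h (Finset.mem_erase.mpr ⟨hit, hi⟩)
            simp only [Finset.mem_insert]
            exact .inr (.inr this)
        · intro h i hi
          obtain ⟨hit, hi⟩ := Finset.mem_erase.mp hi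
          have := h hi
          simp only [Finset.mem_insert] at this
          rcases this with rfl | rfl | h'
          · simp [hn] at hi
          · exact (hit rfl).elim
          · exact h'
      have em : L.map (fun i => (d.erase t) i + 1) = L.map (fun i => d i + 1) :=
        List.map_congr_left fun i hi => by
          have : i ≠ t := fun e => htL (e ▸ hi)
          rw [Finsupp.erase_ne this]
      simp only [e, em]
      split_ifs
      · simp only [List.map_cons, hn, zero_add]
        rw [hf.one j _ _ hj]
        ring
      · simp
    | succ n ihn =>
      have h := hcoef d
      have hd' : ∀ i, i ≠ s → (d - Finsupp.single s 1 : ℕ →₀ ℕ) i = d i := fun i hi => by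
        simp [Ne.symm hi]
      have hds : (d - Finsupp.single s 1 : ℕ →₀ ℕ) s = n := by simp [hn]
      have e : (d - Finsupp.single s 1).support ⊆ (s :: t :: L).toFinset
          ↔ d.support ⊆ (s :: t :: L).toFinset := by
        simp only [Finset.subset_iff, Finsupp.mem_support_iff]
        refine forall_congr' fun i => ?_
        by_cases hi : i = s
        · simp [hi]
        · rw [hd' i hi]
      have em : L.map (fun i => (d - Finsupp.single s 1 : ℕ →₀ ℕ) i + 1) = L.map (fun i => d i + 1) :=
        List.map_congr_left fun i hi => by rw [hd' i fun e => hsL (e ▸ hi)]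
      -- The series for `L` does not involve `s`, so its coefficient vanishes once the exponent at
      -- `s` is positive.
      rw [hn, if_pos (by omega), if_pos (by omega), ihn _ hds, ih1, ih1, ih2,
        if_neg (c := (d.erase t).support ⊆ _)] at h
      · simp only [e, List.map_cons, em, hd' t hst.symm, hds, hn] at h ⊢
        split_ifs at h ⊢ with h0
        · rw [hf.succ j _ _ _ hj]
          linear_combination h
        · linear_combination h
      · intro h'
        have : s ∈ L.toFinset := h' (by simp [hst, hn])
        exact hsL (by simpa using this)

/-- The exponent of the monomial in whose coefficient the entry for `c` appears. -/
noncomputable def exponent (c : List ℕ) : ℕ →₀ ℕ :=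
  Finsupp.onFinset (Finset.Icc 1 c.length)
    (fun i => if i ∈ Finset.Icc 1 c.length then c.getD (i - 1) 0 - 1 else 0)
    fun i hi => by by_contra h; simp [h] at hi

theorem exponent_apply {c : List ℕ} {i : ℕ} (hi : i ∈ Finset.Icc 1 c.length) :
    exponent c i = c.getD (i - 1) 0 - 1 := by
  rw [exponent, Finsupp.onFinset_apply, if_pos hi]

theorem support_exponent (c : List ℕ) : (exponent c).support = posBig c := by
  ext i
  rw [Finsupp.mem_support_iff, posBig, Finset.mem_filter]
  by_cases hi : i ∈ Finset.Icc 1 c.length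
  · rw [exponent_apply hi]
    simp only [hi, true_and]
    omega
  · rw [exponent, Finsupp.onFinset_apply, if_neg hi]
    simp [hi]

theorem reduceFrom_eq_map (A B : Finset ℕ) (c : List ℕ) (s : ℕ) :
    reduceFrom s A B c = ((List.range' s c.length).filter (· ∉ A)).map
      fun i => if i ∈ B then c.getD (i - s) 0 - 1 else c.getD (i - s) 0 := by
  induction c generalizing s with
  | nil => rfl
  | cons a c ih =>
    have e : ((List.range' (s + 1) c.length).filter (· ∉ A)).map
          (fun i => if i ∈ B then c.getD (i - (s + 1)) 0 - 1 else c.getD (i - (s + 1)) 0)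
        = ((List.range' (s + 1) c.length).filter (· ∉ A)).map
          (fun i => if i ∈ B then (a :: c).getD (i - s) 0 - 1 else (a :: c).getD (i - s) 0) := by
      refine List.map_congr_left fun i hi => ?_
      have h := List.mem_range'_1.mp (List.mem_filter.mp hi).1
      rw [show i - s = i - (s + 1) + 1 by omega, List.getD_cons_succ]
    rw [reduceFrom, ih, e, List.length_cons, List.range'_succ, List.filter_cons]
    by_cases hs : s ∈ A <;> simp [hs]

theorem mem_range'_of_filter {A : Finset ℕ} {n i : ℕ}
    (h : i ∈ (List.range' 1 n).filter (· ∉ A)) : i ∈ Finset.Icc 1 n := by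
  have h := List.mem_range'_1.mp (List.mem_filter.mp h).1
  rw [Finset.mem_Icc]
  omega

theorem length_filter_range' {A : Finset ℕ} {n : ℕ} (hA : A ⊆ Finset.Icc 1 n) :
    ((List.range' 1 n).filter (· ∉ A)).length = n - A.card := by
  have hnd : ((List.range' 1 n).filter (· ∉ A)).Nodup := (List.nodup_range' ..).filter _
  rw [← List.toFinset_card_of_nodup hnd]
  rw [toFinset_filter_range', Finset.card_sdiff_of_subset hA, Nat.card_Icc, Nat.add_sub_cancel]

theorem even_length_filter {A : Finset ℕ} {n : ℕ} (hn : Even n) (hA : A ⊆ Finset.Icc 1 n)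
    (hA' : Even A.card) : Even ((List.range' 1 n).filter (· ∉ A)).length := by
  rw [length_filter_range' hA]
  exact hn.tsub hA'

theorem posOne_eq {c : List ℕ} (hc : ∀ m ∈ c, 1 ≤ m) :
    posOne c = Finset.Icc 1 c.length \ posBig c := by
  ext i
  simp only [posOne, posBig, Finset.mem_filter, Finset.mem_sdiff]
  by_cases hi : i ∈ Finset.Icc 1 c.length
  · have := Finset.mem_Icc.mp hi
    have h1 : i - 1 < c.length := by omega
    have h2 := hc (c.getD (i - 1) 0) (by
      rw [List.getD_eq_getElem _ _ h1]; exact List.getElem_mem h1)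
    simp only [hi, true_and]
    omega
  · simp [hi]

theorem prod_X_eq_monomial (B : Finset ℕ) :
    ∏ b ∈ B, (X b : MvPowerSeries ℕ R) = monomial (∑ b ∈ B, Finsupp.single b 1) 1 := by
  induction B using Finset.induction_on with
  | empty => rfl
  | insert a B ha ih =>
    rw [Finset.prod_insert ha, Finset.sum_insert ha, ih, X_def, monomial_mul_monomial, one_mul]

theorem sum_single_apply (B : Finset ℕ) (i : ℕ) :
    (∑ b ∈ B, Finsupp.single b 1 : ℕ →₀ ℕ) i = if i ∈ B then 1 else 0 := by
  rw [Finsupp.finsetSum_apply]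
  simp [Finsupp.single_apply]

/-- The exponent at `i` is `c_i - 1`. A deleted variable must have exponent zero, which forces `A ⊆
posOne c`; a factor `X b` lowers the entry at `b`, which is possible only if that entry exceeds `1`.
-/
theorem coeff_sum_mul_genFun {v : ℕ → R} {ε N : ℕ} {f : ℕ → List ℕ → R}
    (hf : IsTruncated v ε N f) {j : ℕ} (hj : j < N) {c : List ℕ} (hc : ∀ m ∈ c, 1 ≤ m)
    (he : Even c.length) {A : Finset ℕ} (hA : A ⊆ Finset.Icc 1 c.length) (hA' : Even A.card)
    (a : R) (w : Finset ℕ → ℕ) :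
    coeff (exponent c) ((∑ B ∈ (Finset.Icc 1 c.length \ A).powerset,
        (-1) ^ B.card * C a ^ w B * ∏ b ∈ B, X b)
        * genFun v ε N j ((List.range' 1 c.length).filter (· ∉ A)))
      = if A ⊆ posOne c then ∑ B ∈ (posBig c).powerset,
          (-1) ^ B.card * a ^ w B * f j (reduce c A B) else 0 := by
  have hnd : ((List.range' 1 c.length).filter (· ∉ A)).Nodup := (List.nodup_range' ..).filter _
  have htf : ((List.range' 1 c.length).filter (· ∉ A)).toFinset
      = Finset.Icc 1 c.length \ A := toFinset_filter_range' A _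
  have hle : ∀ B : Finset ℕ, ∑ b ∈ B, Finsupp.single b 1 ≤ exponent c ↔ B ⊆ posBig c := by
    intro B
    rw [← support_exponent, Finsupp.le_def]
    constructor
    · intro h i hi
      have := h i
      rw [sum_single_apply, if_pos hi] at this
      rw [Finsupp.mem_support_iff]
      omega
    · intro h i
      rw [sum_single_apply]
      split_ifs with hi
      · have := Finsupp.mem_support_iff.mp (h hi)
        omega
      · exact Nat.zero_le _
  have hterm : ∀ B ∈ (Finset.Icc 1 c.length \ A).powerset,
      coeff (exponent c) ((-1) ^ B.card * C a ^ w B * (∏ b ∈ B, X b)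
        * genFun v ε N j ((List.range' 1 c.length).filter (· ∉ A)))
      = if B ⊆ posBig c then (if A ⊆ posOne c then
          (-1) ^ B.card * a ^ w B * f j (reduce c A B) else 0) else 0 := by
    intro B hB
    rw [Finset.mem_powerset] at hB
    have e : (-1 : MvPowerSeries ℕ R) ^ B.card * C a ^ w B = C ((-1) ^ B.card * a ^ w B) := by
      simp
    rw [e, prod_X_eq_monomial, mul_assoc, coeff_C_mul, coeff_monomial_mul, one_mul]
    simp only [hle]
    split_ifs with h1 h2
    · rw [coeff_genFun hf j hj _ hnd (even_length_filter he hA hA'), if_pos]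
      · congr 2
        rw [reduce, reduceFrom_eq_map]
        refine List.map_congr_left fun i hi => ?_
        have hi' := mem_range'_of_filter hi
        rw [Finsupp.tsub_apply, exponent_apply hi', sum_single_apply]
        have hpos : 1 ≤ c.getD (i - 1) 0 := by
          have := Finset.mem_Icc.mp hi'
          have h1 : i - 1 < c.length := by omega
          rw [List.getD_eq_getElem _ _ h1]
          exact hc _ (List.getElem_mem h1)
        split_ifs with hiB
        · have := (Finset.mem_filter.mp (h1 hiB)).2
          omega
        · omega
      · rw [htf]
        intro i hi
        have : i ∈ posBig c := by
          rw [← support_exponent]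
          exact Finsupp.support_tsub hi
        refine Finset.mem_sdiff.mpr ⟨(Finset.mem_filter.mp this).1, fun hiA => ?_⟩
        have := h2 hiA
        rw [posOne_eq hc] at this
        exact (Finset.mem_sdiff.mp this).2 ‹_›
    · rw [coeff_genFun hf j hj _ hnd (even_length_filter he hA hA'), if_neg, mul_zero]
      intro h
      refine h2 fun i hi => ?_
      rw [posOne_eq hc]
      refine Finset.mem_sdiff.mpr ⟨hA hi, fun hib => ?_⟩
      have hiB : i ∉ B := fun h => (Finset.mem_sdiff.mp (hB h)).2 hi
      rw [← support_exponent, Finsupp.mem_support_iff] at hib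
      have : i ∈ Finset.Icc 1 c.length \ A := by
        rw [← htf]
        apply h
        rw [Finsupp.mem_support_iff, Finsupp.tsub_apply, sum_single_apply, if_neg hiB]
        omega
      exact (Finset.mem_sdiff.mp this).2 hi
    · rw [mul_zero]
  rw [Finset.sum_mul, map_sum, Finset.sum_congr rfl hterm]
  split_ifs with h
  · rw [← Finset.sum_filter]
    refine Finset.sum_congr ?_ fun _ _ => rfl
    ext B
    rw [Finset.mem_filter, Finset.mem_powerset, Finset.mem_powerset]
    refine ⟨fun h => h.2, fun hB => ⟨fun i hi => ?_, hB⟩⟩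
    have := hB hi
    refine Finset.mem_sdiff.mpr ⟨(Finset.mem_filter.mp this).1, fun hiA => ?_⟩
    have h3 := h hiA
    rw [posOne_eq hc] at h3
    exact (Finset.mem_sdiff.mp h3).2 this
  · simp

/-- The recursion in `N` for truncated sums. -/
theorem truncated_recursion {v : ℕ → R} {ε : ℕ} (hε : ε ≤ 1) {f : ℕ → ℕ → List ℕ → R}
    (hf : ∀ N, IsTruncated v ε N (f N))
    (hv : ∀ m n, 1 ≤ m → 1 ≤ n → v (m + n) * (v m + v n - 1) = v m * v n)
    {N : ℕ} (hN : 1 ≤ N) {c : List ℕ} (hc : ∀ m ∈ c, 1 ≤ m) (he : Even c.length) (h0 : c ≠ []) :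
    ∑ B ∈ (posBig c).powerset, (-1) ^ B.card * v N ^ alpha B * f (N + 1) N (reduce c ∅ B)
      = ∑ A ∈ Til (c.length / 2) with A ⊆ posOne c,
          (-1) ^ eo A * (v N ^ ε * (v N - 1)) ^ kappa A
            * ∑ B ∈ (posBig c).powerset,
              (-1) ^ B.card * v N ^ betaRel A B * f N (N - 1) (reduce c A B) := by
  obtain ⟨r, hr⟩ := he.exists_two_nsmul
  rw [smul_eq_mul] at hr
  obtain ⟨n, hn⟩ : ∃ n, 2 * r = n + 2 := by
    have : c.length ≠ 0 := fun h => h0 (List.length_eq_zero_iff.mp h)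
    exact ⟨2 * r - 2, by omega⟩
  have hrange : List.range' 1 (2 * r) = 1 :: 2 :: List.range' 3 n := by
    rw [hn, List.range'_succ, List.range'_succ]
  have hrange' : 2 :: List.range' 3 n = List.range' 2 (n + 1) := by
    rw [List.range'_succ]
  -- With `i = N - 1` the sums start at site `1`, and `V (i + 1) = V N` gives the factor that
  -- `pairProd_tail` needs.
  have key := transfer_recursion (V := fun n => C (v n)) (X := X)
    (I := fun n => geomSeries (v n)) (N := N) hε (fun n i _ => mul_geomSeries (v n) i)
    (fun m n hm hn => by
      rw [← map_add, ← map_one C, ← map_sub, ← map_mul, ← map_mul, hv m n hm hn])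
    (N - 1) (by omega) 1 2 (List.range' 3 n)
  rw [← hrange, hrange', ← sum_Til, Nat.sub_add_cancel hN, pairProd_tail,
    show n + 1 + 1 = c.length by omega] at key
  rw [← hr] at key
  have key := congrArg (coeff (exponent c)) key
  have hl := coeff_sum_mul_genFun (hf (N + 1)) (Nat.lt_succ_self N) hc he
    (Finset.empty_subset _) (by simp) (v N) alpha
  simp only [Finset.sdiff_empty, Finset.notMem_empty, not_false_eq_true, decide_true,
    List.filter_true, Finset.empty_subset, if_true] at hl
  rw [← hl, genFun, key, map_sum, show c.length / 2 = r by omega, Finset.sum_filter]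
  refine Finset.sum_congr rfl fun A hA => ?_
  have hAs : A ⊆ Finset.Icc 1 c.length := hr ▸ Til_subset hA
  have hr' := coeff_sum_mul_genFun (hf N) (show N - 1 < N by omega) hc he hAs
    (even_card_of_mem_Til hA) (v N) (betaRel A)
  have e : (-1 : MvPowerSeries ℕ R) ^ eo A * (C (v N) ^ ε * (C (v N) - 1)) ^ kappa A
      = C ((-1) ^ eo A * (v N ^ ε * (v N - 1)) ^ kappa A) := by simp
  rw [e, coeff_C_mul, pairProd_filter]
  rw [genFun] at hr'
  rw [hr']
  split_ifs
  · rfl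
  · simp

end Coefficients

/-! ### The recursion in `N` for the elements `𝔈_q` -/

section Words

variable {R : Type*} [CommRing R]

/-- Functionals `Ψ N` on `𝔥` whose increments in `N` are computed by stripping the last letter. -/
structure IsIterated (v : ℕ → R) (Ψ : ℕ → H →ₗ[ℤ] R) : Prop where
  one : ∀ N, 1 ≤ N → Ψ N 1 = 1
  init : ∀ a, Ψ 1 (hy * a) = 0
  mul_x : ∀ N a, 1 ≤ N → Ψ (N + 1) (a * hx) - Ψ N (a * hx) = v N * (Ψ (N + 1) a - Ψ N a)
  mul_y : ∀ N a, 1 ≤ N → Ψ (N + 1) (a * hy) - Ψ N (a * hy) = (v N - 1) * Ψ N a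

namespace IsIterated

variable {v : ℕ → R} {Ψ : ℕ → H →ₗ[ℤ] R}

theorem mul_x_pow (h : IsIterated v Ψ) {N : ℕ} (hN : 1 ≤ N) (a : H) (m : ℕ) :
    Ψ (N + 1) (a * hx ^ m) - Ψ N (a * hx ^ m) = v N ^ m * (Ψ (N + 1) a - Ψ N a) := by
  induction m with
  | zero => simp
  | succ m ih => rw [pow_succ, ← mul_assoc, h.mul_x N _ hN, ih]; ring

theorem mul_y_x_pow (h : IsIterated v Ψ) {N : ℕ} (hN : 1 ≤ N) (a : H) (m : ℕ) :
    Ψ (N + 1) (a * (hy * hx ^ m)) - Ψ N (a * (hy * hx ^ m))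
      = v N ^ m * (v N - 1) * Ψ N a := by
  rw [← mul_assoc, h.mul_x_pow hN, h.mul_y N _ hN, mul_assoc]

end IsIterated

/-! ### Evaluating the increments of the elements `𝔈_q` -/

theorem sum_pow_mul_sub_one (v : R) {a b : ℕ} (hab : a ≤ b) :
    ∑ h ∈ Finset.Icc (a + 1) b, v ^ (h - 1) * (v - 1) = v ^ b - v ^ a := by
  induction b, hab using Nat.le_induction with
  | base => simp
  | succ b hb ih =>
    rw [← Finset.insert_Icc_right_eq_Icc_add_one (by omega), Finset.sum_insert (by simp), ih,
      Nat.add_sub_cancel]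
    ring

/-- Appending `y x^(h-1)` multiplies by `v^(h-1) * (v - 1)` in the increment, so the middle sum in
the definition of `𝔈_q` telescopes to an exchange of `v^alpha` for `v^beta`. -/
theorem sum_pow_signed (v : R) (a b : ℕ) :
    ∑ h ∈ Finset.Icc (a + 1) b, v ^ (h - 1) * (v - 1)
      - ∑ h ∈ Finset.Icc (b + 1) a, v ^ (h - 1) * (v - 1) = v ^ b - v ^ a := by
  rcases le_total a b with hab | hab
  · rw [sum_pow_mul_sub_one v hab, Finset.Icc_eq_empty (a := b + 1) (by omega)]
    simp
  · rw [sum_pow_mul_sub_one v hab, Finset.Icc_eq_empty (a := a + 1) (by omega)]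
    simp

/-- The binomial coefficients in `𝔈_q` expand the power of `v - 1` carried by the `k` dominoes; one
further factor `v - 1` comes from the letter `y`. -/
theorem sum_choose_pow (v : R) {k : ℕ} (hk : 1 ≤ k) :
    ∑ h ∈ Finset.Icc 1 k, (-1) ^ (k - h) * ((k - 1).choose (h - 1) : R) * v ^ (h - 1)
      = (v - 1) ^ (k - 1) := by
  obtain ⟨n, rfl⟩ : ∃ n, k = n + 1 := ⟨k - 1, by omega⟩
  rw [sub_eq_add_neg, add_pow, ← Finset.Ico_add_one_right_eq_Icc, Finset.sum_Ico_eq_sum_range,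
    Nat.add_sub_cancel, Nat.add_sub_cancel]
  refine Finset.sum_congr rfl fun i _ => ?_
  rw [Nat.add_sub_cancel_left, show n + 1 - (1 + i) = n - i by omega]
  ring

theorem sum_powerset_posBig (c : List ℕ) (F : Finset ℕ → R) :
    ∑ B ∈ (posBig c).powerset, F B = F ∅ + ∑ B ∈ indexB c, F B := by
  have : (posBig c).powerset = insert ∅ (indexB c) := by
    ext B
    simp only [indexB, Finset.mem_insert, Finset.mem_filter, Finset.mem_powerset]
    rcases B.eq_empty_or_nonempty with rfl | hB
    · simp
    · simp [hB, hB.ne_empty]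
  rw [this, Finset.sum_insert (by simp [indexB])]

theorem sum_Til_posOne (c : List ℕ) (F : Finset ℕ → R) :
    ∑ A ∈ Til (c.length / 2) with A ⊆ posOne c, F A
      = F ∅ + ∑ A ∈ Til (c.length / 2) with A.Nonempty ∧ A ⊆ posOne c, F A := by
  have : {A ∈ Til (c.length / 2) | A ⊆ posOne c}
      = insert ∅ {A ∈ Til (c.length / 2) | A.Nonempty ∧ A ⊆ posOne c} := by
    ext A
    simp only [Finset.mem_insert, Finset.mem_filter]
    rcases A.eq_empty_or_nonempty with rfl | hA
    · simp [empty_mem_Til]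
    · simp [hA, hA.ne_empty]
  rw [this, Finset.sum_insert (by simp)]

theorem betaRel_empty (B : Finset ℕ) : betaRel ∅ B = beta B := by
  have : sigma ∅ = id := by
    ext i
    simp [sigma]
  rw [betaRel, this, Finset.image_id]

theorem reduce_empty (c : List ℕ) : reduce c ∅ ∅ = c := by
  have : ∀ s, reduceFrom s ∅ ∅ c = c := by
    induction c with
    | nil => intro s; rfl
    | cons a c ih => intro s; simp [reduceFrom, ih]
  exact this 1

theorem one_le_kappa {r : ℕ} {A : Finset ℕ} (hA : A ∈ Til r) (h : A.Nonempty) : 1 ≤ kappa A := by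
  obtain ⟨k, hk⟩ := even_card_of_mem_Til hA
  have := h.card_pos
  rw [kappa]
  omega

/-- This is `truncated_recursion` with `Ψ` of words as values. The terms ending in `x^alpha` supply
the left side and a level `N` remainder with `v^alpha`; the middle sum turns the latter into
`v^beta`, the contribution of `A = ∅`, and the last sum gives the nonempty `A`. -/
theorem IsIterated.wordE_recursion {v : ℕ → R} {Ψ : ℕ → H →ₗ[ℤ] R} (h : IsIterated v Ψ)
    (ε : ℕ) {N : ℕ} (hN : 1 ≤ N) {c : List ℕ} (hc : c ≠ []) :
    ∑ B ∈ (posBig c).powerset,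
        (-1) ^ B.card * v N ^ alpha B * Ψ (N + 1) (wordE ε (reduce c ∅ B))
      = ∑ A ∈ Til (c.length / 2) with A ⊆ posOne c,
          (-1) ^ eo A * (v N ^ ε * (v N - 1)) ^ kappa A
            * ∑ B ∈ (posBig c).powerset,
              (-1) ^ B.card * v N ^ betaRel A B * Ψ N (wordE ε (reduce c A B)) := by
  have hmul : ∀ (M : ℕ) (n : ℤ) (a : H), Ψ M (n • a) = n * Ψ M a := fun M n a => by
    rw [map_smul, zsmul_eq_mul]
  have key : Ψ (N + 1) (wordE ε c) - Ψ N (wordE ε c)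
      = -∑ B ∈ indexB c, (-1) ^ B.card * (v N ^ alpha B
          * (Ψ (N + 1) (wordE ε (reduce c ∅ B)) - Ψ N (wordE ε (reduce c ∅ B))))
        + ∑ B ∈ indexB c, (-1) ^ B.card
          * ((v N ^ beta B - v N ^ alpha B) * Ψ N (wordE ε (reduce c ∅ B)))
        + ∑ A ∈ Til (c.length / 2) with A.Nonempty ∧ A ⊆ posOne c,
          (-1) ^ eo A * (v N ^ ε * (v N - 1)) ^ kappa A
            * ∑ B ∈ (posBig c).powerset,
              (-1) ^ B.card * v N ^ betaRel A B * Ψ N (wordE ε (reduce c A B)) := by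
    rw [wordE_eq ε hc]
    simp only [map_add, map_neg, map_sum, hmul]
    have e : ∀ a b d a' b' d' : R, -a + b + d - (-a' + b' + d') = -(a - a') + (b - b') + (d - d') :=
      fun _ _ _ _ _ _ => by ring
    rw [e]
    simp only [← Finset.sum_sub_distrib, ← mul_sub]
    congr 1
    · congr 1
      · congr 1
        refine Finset.sum_congr rfl fun B _ => ?_
        rw [h.mul_x_pow hN]
        push_cast
        rfl
      · refine Finset.sum_congr rfl fun B _ => ?_
        rw [← sum_pow_signed, mul_sub (wordE ε _), map_sub, map_sub]
        have hs : ∀ a b u, Ψ (N + 1) (u * ∑ m ∈ Finset.Icc a b, hy * hx ^ (m - 1))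
            - Ψ N (u * ∑ m ∈ Finset.Icc a b, hy * hx ^ (m - 1))
            = (∑ m ∈ Finset.Icc a b, v N ^ (m - 1) * (v N - 1)) * Ψ N u := by
          intro a b u
          rw [Finset.mul_sum, map_sum, map_sum, ← Finset.sum_sub_distrib, Finset.sum_mul]
          exact Finset.sum_congr rfl fun m _ => h.mul_y_x_pow hN _ _
        push_cast
        linear_combination (-1) ^ B.card * (hs (alpha B + 1) (beta B) (wordE ε (reduce c ∅ B))
          - hs (beta B + 1) (alpha B) (wordE ε (reduce c ∅ B)))
    · rw [indexAB, Finset.sum_product]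
      refine Finset.sum_congr rfl fun A hA => ?_
      rw [Finset.mul_sum]
      refine Finset.sum_congr rfl fun B _ => ?_
      have hk := one_le_kappa (Finset.mem_filter.mp hA).1 (Finset.mem_filter.mp hA).2.1
      simp only []
      have : (v N ^ ε * (v N - 1)) ^ kappa A
        = v N ^ (ε * kappa A) * ((v N - 1) ^ (kappa A - 1) * (v N - 1)) := by
        rw [mul_pow, ← pow_mul, ← pow_succ, Nat.sub_add_cancel hk]
      rw [this, ← sum_choose_pow _ hk]
      simp only [Finset.sum_mul, Finset.mul_sum]
      refine Finset.sum_congr rfl fun m hm => ?_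
      have hm1 := (Finset.mem_Icc.mp hm).1
      rw [h.mul_y_x_pow hN, show m + ε * kappa A + betaRel A B - 1
        = (m - 1) + ε * kappa A + betaRel A B by omega]
      push_cast
      ring
  rw [sum_Til_posOne, sum_powerset_posBig, sum_powerset_posBig]
  have e1 : alpha ∅ = 0 := rfl
  have e2 : beta ∅ = 0 := rfl
  have e3 : eo ∅ = 0 := rfl
  have e4 : kappa ∅ = 0 := rfl
  simp only [reduce_empty, betaRel_empty, e1, e2, e3, e4, Finset.card_empty, pow_zero, one_mul]
  have s1 : ∑ B ∈ indexB c, (-1) ^ B.card * (v N ^ alpha B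
          * (Ψ (N + 1) (wordE ε (reduce c ∅ B)) - Ψ N (wordE ε (reduce c ∅ B))))
      = ∑ B ∈ indexB c, (-1) ^ B.card * v N ^ alpha B * Ψ (N + 1) (wordE ε (reduce c ∅ B))
        - ∑ B ∈ indexB c, (-1) ^ B.card * v N ^ alpha B * Ψ N (wordE ε (reduce c ∅ B)) := by
    rw [← Finset.sum_sub_distrib]
    exact Finset.sum_congr rfl fun _ _ => by ring
  have s2 : ∑ B ∈ indexB c, (-1) ^ B.card
          * ((v N ^ beta B - v N ^ alpha B) * Ψ N (wordE ε (reduce c ∅ B)))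
      = ∑ B ∈ indexB c, (-1) ^ B.card * v N ^ beta B * Ψ N (wordE ε (reduce c ∅ B))
        - ∑ B ∈ indexB c, (-1) ^ B.card * v N ^ alpha B * Ψ N (wordE ε (reduce c ∅ B)) := by
    rw [← Finset.sum_sub_distrib]
    exact Finset.sum_congr rfl fun _ _ => by ring
  rw [s1, s2] at key
  linear_combination key

theorem wordE_mem_range (ε : ℕ) {c : List ℕ} (hc : c ≠ []) : ∃ a, wordE ε c = hy * a := by
  obtain ⟨a, ha⟩ := wordE_mem_of ε 0 (by omega) (by omega)
    (LinearMap.range (LinearMap.mulLeft ℤ hy))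
    (by rintro _ ⟨v, rfl⟩; exact ⟨v * hx, by simp [mul_assoc]⟩)
    (fun m _ => ⟨hx ^ m, by simp⟩)
    (by rintro _ ⟨v, rfl⟩ m _; exact ⟨v * (hy * hx ^ m), by simp [mul_assoc]⟩) c hc
  exact ⟨a, ha.symm⟩

theorem length_reduce {c : List ℕ} {A : Finset ℕ} (B : Finset ℕ)
    (hA : A ⊆ Finset.Icc 1 c.length) : (reduce c A B).length = c.length - A.card := by
  rw [reduce, reduceFrom_eq_map, List.length_map, length_filter_range' hA]

theorem one_le_of_mem_reduce {c : List ℕ} (hc : ∀ m ∈ c, 1 ≤ m) {A B : Finset ℕ}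
    (hB : B ⊆ posBig c) : ∀ m ∈ reduce c A B, 1 ≤ m := by
  intro m hm
  rw [reduce, reduceFrom_eq_map, List.mem_map] at hm
  obtain ⟨i, hi, rfl⟩ := hm
  have hi' := Finset.mem_Icc.mp (mem_range'_of_filter hi)
  have h1 : i - 1 < c.length := by omega
  have hpos : 1 ≤ c.getD (i - 1) 0 := by
    rw [List.getD_eq_getElem _ _ h1]
    exact hc _ (List.getElem_mem h1)
  split_ifs with hiB
  · have := (Finset.mem_filter.mp (hB hiB)).2
    omega
  · exact hpos

/-- Truncated sums are the values of the iterated functionals at the elements `𝔈_q`. -/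
theorem truncated_eq_iterated {v : ℕ → R} {ε : ℕ} (hε : ε ≤ 1) {f : ℕ → ℕ → List ℕ → R}
    (hf : ∀ N, IsTruncated v ε N (f N))
    (hv : ∀ m n, 1 ≤ m → 1 ≤ n → v (m + n) * (v m + v n - 1) = v m * v n)
    {Ψ : ℕ → H →ₗ[ℤ] R} (h : IsIterated v Ψ) {N : ℕ} (hN : 1 ≤ N) : ∀ c : List ℕ,
    (∀ m ∈ c, 1 ≤ m) → Even c.length → f N (N - 1) c = Ψ N (wordE ε c) := by
  induction N, hN using Nat.le_induction with
  | base =>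
    intro c _ he
    rcases c with _ | ⟨a, _ | ⟨b, c⟩⟩
    · rw [(hf 1).nil, wordE_nil, h.one 1 le_rfl]
    -- An odd sequence is excluded; a nonempty even one gives `0` on both sides at `N = 1`, where
    -- there are no sites.
    · simp at he
    · obtain ⟨u, hu⟩ := wordE_mem_range ε (c := a :: b :: c) (by simp)
      rw [hu, h.init]
      exact (hf 1).zero _ _ _
  | succ N hN ih =>
    intro c
    induction hn : c.sum using Nat.strong_induction_on generalizing c with
    | _ n ihn =>
      intro hc he
      by_cases h0 : c = []
      · rw [h0, (hf _).nil, wordE_nil, h.one _ (by omega)]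
      have h1 := truncated_recursion hε hf hv hN hc he h0
      have h2 := h.wordE_recursion ε hN h0
      have e : ∑ A ∈ Til (c.length / 2) with A ⊆ posOne c,
          (-1) ^ eo A * (v N ^ ε * (v N - 1)) ^ kappa A
            * ∑ B ∈ (posBig c).powerset,
              (-1) ^ B.card * v N ^ betaRel A B * f N (N - 1) (reduce c A B)
          = ∑ A ∈ Til (c.length / 2) with A ⊆ posOne c,
          (-1) ^ eo A * (v N ^ ε * (v N - 1)) ^ kappa A
            * ∑ B ∈ (posBig c).powerset,
              (-1) ^ B.card * v N ^ betaRel A B * Ψ N (wordE ε (reduce c A B)) := by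
        refine Finset.sum_congr rfl fun A hA => ?_
        congr 1
        refine Finset.sum_congr rfl fun B hB => ?_
        have hA := Finset.mem_filter.mp hA
        rw [ih _ (one_le_of_mem_reduce hc (Finset.mem_powerset.mp hB))]
        rw [length_reduce B (hA.2.trans (Finset.filter_subset _ _))]
        exact he.tsub (even_card_of_mem_Til hA.1)
      -- Nonempty `B` lowers `c.sum`, so the inner induction cancels these terms and leaves the one
      -- for `c` itself.
      rw [e, ← h2, sum_powerset_posBig, sum_powerset_posBig] at h1
      have e' : ∑ B ∈ indexB c, (-1) ^ B.card * v N ^ alpha B * f (N + 1) N (reduce c ∅ B)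
          = ∑ B ∈ indexB c,
            (-1) ^ B.card * v N ^ alpha B * Ψ (N + 1) (wordE ε (reduce c ∅ B)) := by
        refine Finset.sum_congr rfl fun B hB => ?_
        congr 1
        have hB' := Finset.mem_powerset.mp (Finset.mem_filter.mp hB).1
        refine ihn _ (hn ▸ reduce_lt_of_mem_indexB hB) _ rfl (one_le_of_mem_reduce hc hB') ?_
        rw [length_reduce B (Finset.empty_subset _)]
        simpa using he
      rw [e'] at h1
      have e1 : alpha ∅ = 0 := rfl
      simpa [reduce_empty, e1] using h1

end Words

/-! ### Sums over chains -/

section Chains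

variable {E α R : Type*} [CommRing R]

open Classical in
/-- The sum over the sequences `n` in `D` indexed like `k` whose first entry satisfies `P` and whose
consecutive entries are related by `rel`. -/
noncomputable def chainSum (D : Finset α) (wt : E → α → R) (rel : E → α → α → Prop) :
    List E → (α → Prop) → R
  | [], _ => 1
  | a :: k, P => ∑ n ∈ D, if P n then wt a n * chainSum D wt rel k (rel a n) else 0

theorem sum_piFinset_cons (D : Finset α) (m : ℕ) (g : (Fin (m + 1) → α) → R) :
    ∑ n ∈ Fintype.piFinset (fun _ : Fin (m + 1) => D), g n
      = ∑ a ∈ D, ∑ n ∈ Fintype.piFinset (fun _ : Fin m => D), g (Fin.cons a n) := by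
  rw [← Finset.sum_product']
  refine Finset.sum_nbij' (fun n => (n 0, Fin.tail n)) (fun p => Fin.cons p.1 p.2) ?_ ?_ ?_ ?_ ?_
  · intro n hn
    rw [Fintype.mem_piFinset] at hn
    exact Finset.mem_product.mpr ⟨hn 0, Fintype.mem_piFinset.mpr fun i => hn i.succ⟩
  · rintro ⟨a, n⟩ hp
    obtain ⟨h1, h2⟩ := Finset.mem_product.mp hp
    rw [Fintype.mem_piFinset] at h2 ⊢
    exact Fin.cases h1 h2
  · intro n _
    exact Fin.cons_self_tail n
  · intro p _
    rfl
  · intro n _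
    rw [Fin.cons_self_tail]

-- The condition `P` on the first index carries the relation imposed by the preceding entry, so the
-- product space can be summed one coordinate at a time.
open Classical in
theorem sum_piFinset_eq_chainSum (D : Finset α) (wt : E → α → R) (rel : E → α → α → Prop)
    (k : List E) : ∀ P : α → Prop,
    (∑ n ∈ Fintype.piFinset (fun _ : Fin k.length => D),
      if (∀ i j : Fin k.length, (j : ℕ) = i + 1 → rel (k.get i) (n i) (n j))
          ∧ ∀ i : Fin k.length, (i : ℕ) = 0 → P (n i) then
        ∏ i, wt (k.get i) (n i) else 0)
      = chainSum D wt rel k P := by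
  induction k with
  | nil =>
    intro P
    have : IsEmpty (Fin ([] : List E).length) := inferInstanceAs (IsEmpty (Fin 0))
    rw [chainSum, Fintype.piFinset_of_isEmpty]
    simp
  | cons a k ih =>
    intro P
    have := sum_piFinset_cons D k.length (fun n : Fin (a :: k).length → α =>
      if (∀ i j : Fin (a :: k).length, (j : ℕ) = i + 1 → rel ((a :: k).get i) (n i) (n j))
          ∧ ∀ i : Fin (a :: k).length, (i : ℕ) = 0 → P (n i) then
        ∏ i, wt ((a :: k).get i) (n i) else 0)
    refine this.trans ?_
    rw [chainSum]
    refine Finset.sum_congr rfl fun b _ => ?_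
    rw [← ih, Finset.mul_sum]
    have hcond : ∀ n : Fin k.length → α,
        ((∀ i j : Fin (a :: k).length, (j : ℕ) = i + 1 → rel ((a :: k).get i)
            ((Fin.cons b n : Fin (k.length + 1) → α) i) ((Fin.cons b n : Fin (k.length + 1) → α) j))
          ∧ ∀ i : Fin (a :: k).length, (i : ℕ) = 0 →
            P ((Fin.cons b n : Fin (k.length + 1) → α) i))
        ↔ P b ∧ (∀ i j : Fin k.length, (j : ℕ) = i + 1 → rel (k.get i) (n i) (n j))
          ∧ ∀ i : Fin k.length, (i : ℕ) = 0 → rel a b (n i) := by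
      intro n
      constructor
      · rintro ⟨h1, h2⟩
        refine ⟨h2 0 rfl, fun i j hij => ?_, fun i hi => ?_⟩
        · exact h1 i.succ j.succ (by simp [hij])
        · exact h1 0 i.succ (by simp [hi])
      · rintro ⟨h0, h1, h2⟩
        refine ⟨?_, ?_⟩
        · intro i j
          refine Fin.cases ?_ (fun i => ?_) i <;> refine Fin.cases ?_ (fun j => ?_) j
          · simp
          · intro hij
            exact h2 j (by simpa using hij)
          · simp
          · intro hij
            exact h1 i j (by simpa using hij)
        · intro i
          refine Fin.cases ?_ (fun i => ?_) i
          · exact fun _ => h0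
          · simp
    by_cases hP : P b
    · rw [if_pos hP]
      refine Finset.sum_congr rfl fun n _ => ?_
      simp only [hcond, hP, true_and]
      split_ifs
      · exact Fin.prod_univ_succ _
      · simp
    · rw [if_neg hP]
      refine Finset.sum_eq_zero fun n _ => if_neg ?_
      rw [hcond]
      exact fun h => hP h.1

/-- Nested sums over `m ≤ n₁ ≤ n₂ ≤ ⋯ < N`, where an entry `a` at `n` has weight `wt₀ a n` if the
next index may be equal to `n` and weight `wt₁ a n` if it must be larger, and both are added. -/
def nestedSum (wt₀ wt₁ : E → ℕ → R) (N : ℕ) : List E → ℕ → R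
  | [], _ => 1
  | a :: k, m => ∑ n ∈ Finset.Ico m N,
      (wt₀ a n * nestedSum wt₀ wt₁ N k n + wt₁ a n * nestedSum wt₀ wt₁ N k (n + 1))

theorem nestedSum_cons_self (wt₀ wt₁ : E → ℕ → R) (N : ℕ) (a : E) (k : List E) :
    nestedSum wt₀ wt₁ N (a :: k) N = 0 := by
  simp [nestedSum]

theorem nestedSum_cons (wt₀ wt₁ : E → ℕ → R) {N m : ℕ} (hm : m < N) (a : E) (k : List E) :
    nestedSum wt₀ wt₁ N (a :: k) m = wt₀ a m * nestedSum wt₀ wt₁ N k m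
      + wt₁ a m * nestedSum wt₀ wt₁ N k (m + 1) + nestedSum wt₀ wt₁ N (a :: k) (m + 1) := by
  rw [nestedSum, Finset.sum_eq_sum_Ico_succ_bot hm, nestedSum]

/-- As the indices increase strictly, the new terms are those whose last index is `N`, all others
being smaller. -/
theorem nestedSum_append (wt : E → ℕ → R) {N : ℕ} (a : E) (k : List E) : ∀ m ≤ N,
    nestedSum 0 wt (N + 1) (k ++ [a]) m
      = nestedSum 0 wt N (k ++ [a]) m + nestedSum 0 wt N k m * wt a N := by
  induction k with
  | nil =>
    intro m hm
    simp [nestedSum, Finset.sum_Ico_succ_top hm]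
  | cons b k ih =>
    intro m hm
    have h0 : nestedSum 0 wt (N + 1) (k ++ [a]) (N + 1) = 0 := by
      rcases k with _ | ⟨b, k⟩ <;> exact nestedSum_cons_self _ _ _ _ _
    simp only [List.cons_append, nestedSum]
    rw [Finset.sum_Ico_succ_top hm, h0, Finset.sum_mul, ← Finset.sum_add_distrib]
    simp only [Pi.zero_apply, zero_mul, mul_zero, add_zero, zero_add]
    refine Finset.sum_congr rfl fun n hn => ?_
    rw [ih (n + 1) (by have := Finset.mem_Ico.mp hn; omega)]
    ring

theorem sum_Ioo_ite {N m : ℕ} (hm : 1 ≤ m) (g : ℕ → R) (p : ℕ → Prop) [DecidablePred p]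
    (hp : ∀ n, p n ↔ m ≤ n) :
    (∑ n ∈ Finset.Ioo 0 N, if p n then g n else 0) = ∑ n ∈ Finset.Ico m N, g n := by
  rw [← Finset.sum_filter]
  refine Finset.sum_congr ?_ fun _ _ => rfl
  ext n
  simp only [hp, Finset.mem_filter, Finset.mem_Ioo, Finset.mem_Ico]
  omega

end Chains

/-! ### The truncated values as nested sums -/

theorem X_pow_mul_qinv {n : ℕ} (hn : 1 ≤ n) : PowerSeries.X ^ n * qinv n = qinv n - 1 := by
  linear_combination -(mul_qinv hn)

/-- This is `q^(m+n) = q^m * q^n` written with `q^n = 1 - 1 / qinv n`. The relation is stable under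
`v ↦ 1 - v`, hence also serves the diamond values. -/
theorem qinv_add {m n : ℕ} (hm : 1 ≤ m) (hn : 1 ≤ n) :
    qinv (m + n) * (qinv m + qinv n - 1) = qinv m * qinv n := by
  have h1 := X_pow_mul_qinv hm
  have h2 := X_pow_mul_qinv hn
  have h3 := mul_qinv (show 1 ≤ m + n by omega)
  rw [pow_add] at h3
  linear_combination qinv (m + n) * qinv n * PowerSeries.X ^ n * h1
    + qinv (m + n) * (qinv m - 1) * h2 + qinv m * qinv n * h3

/-- The weight of an entry after which the next index may be equal. -/
noncomputable def daggerWeak (N : ℕ) : Entry → ℕ → PowerSeries ℤ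
  | .bar, n => qinv (N - n)
  | .int _, _ => 0

/-- The weight of an entry after which the next index must be larger. -/
noncomputable def daggerStrict : Entry → ℕ → PowerSeries ℤ
  | .bar, _ => 0
  | .int k, n => PowerSeries.X ^ n * qinv n ^ k

theorem zetaDagger_eq (N : ℕ) (k : List Entry) :
    zetaDagger N k = nestedSum (daggerWeak N) daggerStrict N k 1 := by
  classical
  have key : ∀ (k : List Entry) (m : ℕ), 1 ≤ m →
      ∀ P : ℕ → Prop, (∀ n, P n ↔ m ≤ n) →
      chainSum (Finset.Ioo 0 N) (fun e n => daggerWeak N e n + daggerStrict e n)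
        (fun e n n' => n ≤ n' ∧ (e ≠ Entry.bar → n < n')) k P
      = nestedSum (daggerWeak N) daggerStrict N k m := by
    intro k
    induction k with
    | nil => intro m _ P _; rfl
    | cons a k ih =>
      intro m hm P hP
      rw [chainSum, sum_Ioo_ite hm _ _ hP, nestedSum]
      refine Finset.sum_congr rfl fun n hn => ?_
      have hn := Finset.mem_Ico.mp hn
      cases a with
      | bar => rw [ih n (by omega) _ (by simp)]; simp [daggerStrict]
      | int j =>
        rw [ih (n + 1) (by omega) _ fun n' => by simp; omega]
        simp [daggerWeak]
  have h := key k 1 le_rfl (fun n => 1 ≤ n) fun _ => Iff.rfl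
  rw [← h, ← sum_piFinset_eq_chainSum, zetaDagger, Finset.sum_filter]
  refine Finset.sum_congr rfl fun n hn => ?_
  have hn' : ∀ i, 1 ≤ n i := fun i => (Finset.mem_Ioo.mp (Fintype.mem_piFinset.mp hn i)).1
  simp only [hn', implies_true, and_true]
  refine if_congr Iff.rfl (Finset.prod_congr rfl fun i _ => ?_) rfl
  generalize k.get i = e
  cases e <;> simp [daggerWeak, daggerStrict]

theorem zetaBZ_eq (N : ℕ) (k : List ℕ) : zetaBZ N k
    = nestedSum 0 (fun a n => PowerSeries.X ^ (n * (a - 1)) * qinv n ^ a) N k 1 := by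
  classical
  have key : ∀ (k : List ℕ) (m : ℕ), 1 ≤ m → ∀ P : ℕ → Prop, (∀ n, P n ↔ m ≤ n) →
      chainSum (Finset.Ioo 0 N)
        (fun (a : ℕ) n => (PowerSeries.X ^ (n * (a - 1)) * qinv n ^ a : PowerSeries ℤ))
        (fun _ n n' => n < n') k P
      = nestedSum 0 (fun a n => PowerSeries.X ^ (n * (a - 1)) * qinv n ^ a) N k m := by
    intro k
    induction k with
    | nil => intro m _ P _; rfl
    | cons a k ih =>
      intro m hm P hP
      rw [chainSum, sum_Ioo_ite hm _ _ hP, nestedSum]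
      refine Finset.sum_congr rfl fun n hn => ?_
      have hn := Finset.mem_Ico.mp hn
      rw [ih (n + 1) (by omega) (fun n' => n < n') fun n' => Iff.rfl]
      simp
  have h := key k 1 le_rfl (fun n => 1 ≤ n) fun _ => Iff.rfl
  rw [← h, ← sum_piFinset_eq_chainSum, zetaBZ, Finset.sum_filter]
  refine Finset.sum_congr rfl fun n hn => ?_
  have hn' : ∀ i, 1 ≤ n i := fun i => (Finset.mem_Ioo.mp (Fintype.mem_piFinset.mp hn i)).1
  simp only [hn', implies_true, and_true]

/-- The weight of an entry, equal to `1` and marked, after which the next index may be equal. -/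
noncomputable def diamondWeak (N a n : ℕ) : PowerSeries ℤ :=
  if a = 1 then PowerSeries.X ^ (N - n) * qinv (N - n) else 0

/-- The weight of an unmarked entry. -/
noncomputable def diamondStrict (a n : ℕ) : PowerSeries ℤ :=
  PowerSeries.X ^ (n * (a - 1)) * qinv n ^ a

/-- Recording membership in `A` as a Boolean attached to each index makes the diamond value a sum
over chains. -/
theorem sum_powerset_sum_piFinset {R : Type*} [CommRing R] (D : Finset ℕ) (m : ℕ)
    (g : (Fin m → ℕ × Bool) → R) :
    ∑ A ∈ (Finset.univ : Finset (Fin m)).powerset, ∑ n ∈ Fintype.piFinset fun _ : Fin m => D,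
        g (fun i => (n i, decide (i ∈ A)))
      = ∑ w ∈ Fintype.piFinset (fun _ : Fin m => D ×ˢ (Finset.univ : Finset Bool)), g w := by
  rw [← Finset.sum_product']
  refine Finset.sum_nbij' (fun p i => (p.2 i, decide (i ∈ p.1)))
    (fun w => (Finset.univ.filter fun i => (w i).2 = true, fun i => (w i).1)) ?_ ?_ ?_ ?_ ?_
  · rintro ⟨A, n⟩ hp
    have := Fintype.mem_piFinset.mp (Finset.mem_product.mp hp).2
    exact Fintype.mem_piFinset.mpr fun i => Finset.mem_product.mpr ⟨this i, Finset.mem_univ _⟩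
  · intro w hw
    rw [Fintype.mem_piFinset] at hw
    simp only [Finset.mem_product, Finset.mem_univ, and_true] at hw
    simpa [Fintype.mem_piFinset] using hw
  · rintro ⟨A, n⟩ _
    simp
  · intro w _
    ext i <;> simp
  · intro p _
    rfl

theorem zetaDiamondBZ_eq (N : ℕ) (k : List ℕ) :
    zetaDiamondBZ N k = nestedSum (diamondWeak N) diamondStrict N k 1 := by
  classical
  set wt : ℕ → ℕ × Bool → PowerSeries ℤ := fun a w =>
    if w.2 then diamondWeak N a w.1 else diamondStrict a w.1 with hwt
  set rel : ℕ → ℕ × Bool → ℕ × Bool → Prop := fun _ w w' =>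
    w.1 ≤ w'.1 ∧ (w.2 = false → w.1 < w'.1) with hrel
  have key : ∀ (k : List ℕ) (m : ℕ), 1 ≤ m → ∀ P : ℕ × Bool → Prop, (∀ w, P w ↔ m ≤ w.1) →
      chainSum (Finset.Ioo 0 N ×ˢ (Finset.univ : Finset Bool)) wt rel k P
      = nestedSum (diamondWeak N) diamondStrict N k m := by
    intro k
    induction k with
    | nil => intro m _ P _; rfl
    | cons a k ih =>
      intro m hm P hP
      rw [chainSum, Finset.sum_product, nestedSum]
      simp only [hP]
      rw [← sum_Ioo_ite hm _ (fun n => m ≤ n) fun _ => Iff.rfl]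
      refine Finset.sum_congr rfl fun n _ => ?_
      split_ifs with hn
      · rw [Fintype.sum_bool, ih n (by omega) _ (by simp [hrel]),
          ih (n + 1) (by omega) _ fun w => by simp [hrel]; omega]
        simp [hwt]
      · simp
  have h := key k 1 le_rfl (fun w => 1 ≤ w.1) fun _ => Iff.rfl
  rw [← h, ← sum_piFinset_eq_chainSum, ← sum_powerset_sum_piFinset, zetaDiamondBZ]
  have hsub : (Finset.univ.filter fun i : Fin k.length => k.get i = 1).powerset
      ⊆ (Finset.univ : Finset (Fin k.length)).powerset :=
    Finset.powerset_mono.mpr (Finset.subset_univ _)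
  have hprod : ∀ (A : Finset (Fin k.length)) (n : Fin k.length → ℕ),
      ∏ i, wt (k.get i) (n i, decide (i ∈ A))
        = (∏ i ∈ A, diamondWeak N (k.get i) (n i))
          * ∏ i ∈ Aᶜ, diamondStrict (k.get i) (n i) := by
    intro A n
    rw [← Finset.prod_mul_prod_compl A]
    congr 1
    · exact Finset.prod_congr rfl fun i hi => by simp [hwt, hi]
    · exact Finset.prod_congr rfl fun i hi => by simp [hwt, Finset.mem_compl.mp hi]
  simp only [hprod]
  -- All subsets `A` may be allowed, because a marked entry different from `1` has weight zero.
  rw [← Finset.sum_subset hsub]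
  · refine Finset.sum_congr rfl fun A hA => ?_
    rw [Finset.sum_filter]
    refine Finset.sum_congr rfl fun n hn => ?_
    have hn' : ∀ i, 1 ≤ n i := fun i => (Finset.mem_Ioo.mp (Fintype.mem_piFinset.mp hn i)).1
    simp only [hn', implies_true, and_true, hrel, decide_eq_false_iff_not]
    refine if_congr Iff.rfl (congrArg₂ _ (Finset.prod_congr rfl fun i hi => ?_) rfl) rfl
    have := (Finset.mem_filter.mp (Finset.mem_powerset.mp hA hi)).2
    rw [diamondWeak, if_pos this]
  · intro A _ hA
    refine Finset.sum_eq_zero fun n _ => ?_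
    obtain ⟨i, hi, hik⟩ : ∃ i ∈ A, k.get i ≠ 1 := by
      by_contra! hcon
      exact hA (Finset.mem_powerset.mpr fun i hi => by simpa using hcon i hi)
    rw [Finset.prod_eq_zero hi (by rw [diamondWeak, if_neg hik]), zero_mul, ite_self]

/-! ### The recursions for the truncated values -/

/-- `({1̄}^{l_1 - 1}, k_1, …)` for the sequence `(l_1, k_1, …)`. -/
def daggerList : List ℕ → List Entry
  | l :: k :: c => List.replicate (l - 1) Entry.bar ++ Entry.int k :: daggerList c
  | _ => []

/-- `({1}^{l_1 - 1}, k_1 + 1, …)` for the sequence `(l_1, k_1, …)`. -/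
def diamondList : List ℕ → List ℕ
  | l :: k :: c => List.replicate (l - 1) 1 ++ (k + 1) :: diamondList c
  | _ => []

theorem interleave_succ {r : ℕ} (l k : Fin (r + 1) → ℕ) :
    interleave l k = l 0 :: k 0 :: interleave (Fin.tail l) (Fin.tail k) := by
  simp [interleave, List.ofFn_succ, Fin.tail]

theorem daggerList_interleave {r : ℕ} (l k : Fin r → ℕ) :
    daggerList (interleave l k) = daggerIndex l k := by
  induction r with
  | zero => rfl
  | succ r ih =>
    rw [interleave_succ, daggerList, ih]
    simp [daggerIndex, List.ofFn_succ, Fin.tail]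

theorem diamondList_interleave {r : ℕ} (l k : Fin r → ℕ) :
    diamondList (interleave l k) = diamondIndex l k := by
  induction r with
  | zero => rfl
  | succ r ih =>
    rw [interleave_succ, diamondList, ih]
    simp [diamondIndex, List.ofFn_succ, Fin.tail]

/-- Split off the terms whose first index is `N - (j + 1)`: a bar there has weight `qinv (j + 1)`
and leaves the site available. -/
theorem isTruncated_dagger (N : ℕ) : IsTruncated qinv 0 N fun j c =>
    nestedSum (daggerWeak N) daggerStrict N (daggerList c) (N - j) where
  nil _ := rfl
  zero l k c := by
    rw [Nat.sub_zero, daggerList]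
    cases l - 1 <;> exact nestedSum_cons_self _ _ _ _ _
  one j k c hj := by
    have h := X_pow_mul_qinv (show 1 ≤ N - (j + 1) by omega)
    simp only [daggerList, Nat.sub_self, List.replicate_zero, List.nil_append]
    rw [nestedSum_cons _ _ (show N - (j + 1) < N by omega),
      show N - (j + 1) + 1 = N - j by omega]
    simp only [daggerWeak, daggerStrict]
    linear_combination qinv (N - (j + 1)) ^ k
      * nestedSum (daggerWeak N) daggerStrict N (daggerList c) (N - j) * h
  succ j l k c hj := by
    simp only [daggerList, show l + 2 - 1 = l + 1 by omega, Nat.add_sub_cancel,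
      List.replicate_succ, List.cons_append]
    rw [nestedSum_cons _ _ (show N - (j + 1) < N by omega),
      show N - (j + 1) + 1 = N - j by omega]
    simp only [daggerWeak, daggerStrict, show N - (N - (j + 1)) = j + 1 by omega]
    push_cast
    ring

/-- A leading `1` at `N - (j + 1)` is either marked, with weight `qinv (j + 1) - 1`, or unmarked,
with weight `qinv (N - (j + 1))`. The unmarked case is the term with `ε`, and the sign `(-1) ^
c.sum` turns the marked weight into `v (j + 1)`. -/
theorem isTruncated_diamond (N : ℕ) : IsTruncated (fun n => 1 - qinv n) 1 N fun j c =>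
    (-1) ^ c.sum * nestedSum (diamondWeak N) diamondStrict N (diamondList c) (N - j) where
  nil _ := by simp [diamondList, nestedSum]
  zero l k c := by
    rw [Nat.sub_zero, diamondList]
    cases l - 1 <;> exact mul_eq_zero_of_right _ (nestedSum_cons_self _ _ _ _ _)
  one j k c hj := by
    have h := X_pow_mul_qinv (show 1 ≤ N - (j + 1) by omega)
    simp only [diamondList, Nat.sub_self, List.replicate_zero, List.nil_append, List.sum_cons]
    rw [nestedSum_cons _ _ (show N - (j + 1) < N by omega),
      show N - (j + 1) + 1 = N - j by omega]
    have h0 : diamondWeak N (k + 1 + 1) (N - (j + 1)) = 0 := if_neg (by omega)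
    have h1 : diamondStrict (k + 1 + 1) (N - (j + 1))
        = (qinv (N - (j + 1)) - 1) ^ (k + 1) * qinv (N - (j + 1)) := by
      rw [diamondStrict, Nat.add_sub_cancel, pow_mul, ← h, mul_pow]
      ring
    have h2 : (1 - qinv (N - (j + 1))) ^ k = (-1) ^ k * (qinv (N - (j + 1)) - 1) ^ k := by
      rw [← mul_pow]
      ring
    simp only [h0, h1, h2]
    ring
  succ j l k c hj := by
    have h := X_pow_mul_qinv (show 1 ≤ j + 1 by omega)
    simp only [diamondList, show l + 2 - 1 = l + 1 by omega, Nat.add_sub_cancel,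
      List.replicate_succ, List.cons_append, List.sum_cons]
    rw [nestedSum_cons _ _ (show N - (j + 1) < N by omega),
      show N - (j + 1) + 1 = N - j by omega]
    have h0 : diamondWeak N 1 (N - (j + 1)) = qinv (j + 1) - 1 := by
      rw [diamondWeak, if_pos rfl, show N - (N - (j + 1)) = j + 1 by omega, h]
    have h1 : diamondStrict 1 (N - (j + 1)) = qinv (N - (j + 1)) := by
      simp [diamondStrict]
    rw [h0, h1]
    push_cast
    ring

/-! ### Functionals on words -/

/-- The linear map on `𝔥` that extends `linearOnWords f`. -/
noncomputable def onWords (f : List ℕ → PowerSeries ℤ) : H →ₗ[ℤ] PowerSeries ℤ :=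
  (FreeAlgebra.basisFreeMonoid ℤ Letter).constr ℤ fun w : FreeMonoid Letter =>
    if (parse w.toList).1 = 0 then f (parse w.toList).2 else 0

theorem basisFreeMonoid_ofList (w : List Letter) :
    FreeAlgebra.basisFreeMonoid ℤ Letter (FreeMonoid.ofList w)
      = (w.map (FreeAlgebra.ι ℤ)).prod := by
  simp [FreeAlgebra.basisFreeMonoid, FreeAlgebra.equivMonoidAlgebraFreeMonoid,
    FreeMonoid.lift_apply]
  exact one_smul ℤ _

theorem onWords_prod (f : List ℕ → PowerSeries ℤ) (w : List Letter) :
    onWords f (w.map (FreeAlgebra.ι ℤ)).prod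
      = if (parse w).1 = 0 then f (parse w).2 else 0 := by
  rw [← basisFreeMonoid_ofList, onWords, Module.Basis.constr_basis]
  rfl

theorem H_induction {p : H → Prop} (h : ∀ w : List Letter, p (w.map (FreeAlgebra.ι ℤ)).prod)
    (hadd : ∀ a b, p a → p b → p (a + b)) (hsmul : ∀ (n : ℤ) a, p a → p (n • a)) (a : H) :
    p a := by
  have ha := (FreeAlgebra.basisFreeMonoid ℤ Letter).mem_span a
  induction ha using Submodule.span_induction with
  | mem x hx =>
    obtain ⟨w, rfl⟩ := hx
    have := h w.toList
    rw [← basisFreeMonoid_ofList] at this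
    exact this
  | zero => simpa using hsmul 0 _ (h [])
  | add a b _ _ iha ihb => exact hadd a b iha ihb
  | smul n a _ iha => exact hsmul n a iha

theorem parse_append_y (w : List Letter) :
    parse (w ++ [Letter.y]) = ((parse w).1, (parse w).2 ++ [1]) := by
  induction w with
  | nil => rfl
  | cons a w ih => cases a <;> simp [parse, ih]

theorem parse_append_x (w : List Letter) :
    (parse w).2 = [] ∧ parse (w ++ [Letter.x]) = ((parse w).1 + 1, [])
      ∨ ∃ k m, (parse w).2 = k ++ [m + 1] ∧ parse (w ++ [Letter.x]) = ((parse w).1, k ++ [m + 2])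
      := by
  induction w with
  | nil => exact .inl ⟨rfl, rfl⟩
  | cons a w ih =>
    cases a with
    | x =>
      rcases ih with ⟨h1, h2⟩ | ⟨k, m, h1, h2⟩
      · exact .inl ⟨h1, by simp [parse, h2]⟩
      · exact .inr ⟨k, m, h1, by simp [parse, h2]⟩
    | y =>
      rcases ih with ⟨h1, h2⟩ | ⟨k, m, h1, h2⟩
      · exact .inr ⟨[], (parse w).1, by simp [parse, h1], by simp [parse, h2]⟩
      · exact .inr ⟨((parse w).1 + 1) :: k, m, by simp [parse, h1], by simp [parse, h2]⟩

section

variable {wt : ℕ → ℕ → PowerSeries ℤ}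

theorem onWords_one (N : ℕ) : onWords (fun k => nestedSum 0 wt N k 1) 1 = 1 := by
  have := onWords_prod (fun k => nestedSum 0 wt N k 1) []
  simpa [parse, nestedSum] using this

theorem onWords_hy_mul (a : H) : onWords (fun k => nestedSum 0 wt 1 k 1) (hy * a) = 0 := by
  induction a using H_induction with
  | h w =>
    have := onWords_prod (fun k => nestedSum 0 wt 1 k 1) (Letter.y :: w)
    rw [List.map_cons, List.prod_cons] at this
    refine this.trans ?_
    simp [parse, nestedSum]
  | hadd a b ha hb => rw [mul_add, map_add, ha, hb, add_zero]
  | hsmul n a ha => rw [mul_smul_comm, map_smul, ha, smul_zero]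

/-- A final `x` raises the last exponent, hence multiplies the weight at the last index `N` by `p
N`. Words without `y` have value independent of `N`. -/
theorem onWords_mul_hx {p : ℕ → PowerSeries ℤ} {N : ℕ} (hN : 1 ≤ N)
    (hp : ∀ m, wt (m + 2) N = p N * wt (m + 1) N) (a : H) :
    onWords (fun k => nestedSum 0 wt (N + 1) k 1) (a * hx)
      - onWords (fun k => nestedSum 0 wt N k 1) (a * hx)
      = p N * (onWords (fun k => nestedSum 0 wt (N + 1) k 1) a
        - onWords (fun k => nestedSum 0 wt N k 1) a) := by
  induction a using H_induction with
  | h w =>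
    have e : (w.map (FreeAlgebra.ι ℤ)).prod * hx
      = ((w ++ [Letter.x]).map (FreeAlgebra.ι ℤ)).prod := by simp [hx]
    rw [e, onWords_prod, onWords_prod, onWords_prod, onWords_prod]
    rcases parse_append_x w with ⟨h1, h2⟩ | ⟨k, m, h1, h2⟩
    · simp [h1, h2, nestedSum]
    · rw [h1, h2]
      simp only []
      split_ifs
      · rw [nestedSum_append _ _ _ _ hN, nestedSum_append _ _ _ _ hN, hp]
        ring
      · ring
  | hadd a b ha hb =>
    simp only [add_mul, map_add]
    linear_combination ha + hb
  | hsmul n a ha =>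
    rw [smul_mul_assoc, map_smul, map_smul, map_smul, map_smul, ← smul_sub, ← smul_sub, ha,
      mul_smul_comm]

theorem onWords_mul_hy {N : ℕ} (hN : 1 ≤ N) (a : H) :
    onWords (fun k => nestedSum 0 wt (N + 1) k 1) (a * hy)
      - onWords (fun k => nestedSum 0 wt N k 1) (a * hy)
      = wt 1 N * onWords (fun k => nestedSum 0 wt N k 1) a := by
  induction a using H_induction with
  | h w =>
    have e : (w.map (FreeAlgebra.ι ℤ)).prod * hy
      = ((w ++ [Letter.y]).map (FreeAlgebra.ι ℤ)).prod := by simp [hy]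
    rw [e, onWords_prod, onWords_prod, onWords_prod, parse_append_y]
    simp only []
    split_ifs
    · rw [nestedSum_append _ _ _ _ hN]
      ring
    · ring
  | hadd a b ha hb =>
    simp only [add_mul, map_add]
    linear_combination ha + hb
  | hsmul n a ha =>
    rw [smul_mul_assoc, map_smul, map_smul, map_smul, ← smul_sub, ha, mul_smul_comm]

end

theorem zetaDagger_map_int (N : ℕ) (k : List ℕ) : zetaDagger N (k.map Entry.int)
    = nestedSum 0 (fun a n => PowerSeries.X ^ n * qinv n ^ a) N k 1 := by
  have : ∀ m, nestedSum (daggerWeak N) daggerStrict N (k.map Entry.int) m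
      = nestedSum 0 (fun a n => PowerSeries.X ^ n * qinv n ^ a) N k m := by
    induction k with
    | nil => intro m; rfl
    | cons a k ih => intro m; simp [nestedSum, daggerWeak, daggerStrict, ih]
  rw [zetaDagger_eq, this]

theorem isIterated_dagger :
    IsIterated qinv fun N => onWords fun k => zetaDagger N (k.map Entry.int) := by
  simp only [zetaDagger_map_int]
  refine ⟨fun N _ => onWords_one N, onWords_hy_mul, fun N a hN => ?_, fun N a hN => ?_⟩
  · exact onWords_mul_hx hN (fun m => by ring) a
  · rw [onWords_mul_hy hN, pow_one, X_pow_mul_qinv hN]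

theorem theta_hx : theta hx = -hx := by simp [theta, hx]

theorem theta_hy : theta hy = -hy := by simp [theta, hy]

/-- The Bradley–Zhao weights of the letters are `qinv N - 1 = -v N` for `x` and `qinv N = -(v N -
1)` for `y`; `theta` supplies the sign of each letter. -/
theorem isIterated_BZ : IsIterated (fun n => 1 - qinv n)
    fun N => (onWords fun k => zetaBZ N k) ∘ₗ theta.toLinearMap := by
  simp only [zetaBZ_eq]
  refine ⟨fun N _ => ?_, fun a => ?_, fun N a hN => ?_, fun N a hN => ?_⟩
  · simpa using onWords_one N
  · simp [theta_hy, onWords_hy_mul]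
  · have := onWords_mul_hx (wt := fun a n => PowerSeries.X ^ (n * (a - 1)) * qinv n ^ a)
      (p := fun n => qinv n - 1) hN (fun m => by
        rw [← X_pow_mul_qinv hN, show m + 2 - 1 = m + 1 by omega, Nat.add_sub_cancel]
        ring) (theta a)
    simp only [LinearMap.comp_apply, AlgHom.toLinearMap_apply, map_mul, theta_hx, mul_neg,
      map_neg]
    linear_combination -this
  · have := onWords_mul_hy (wt := fun a n => PowerSeries.X ^ (n * (a - 1)) * qinv n ^ a)
      hN (theta a)
    simp only [LinearMap.comp_apply, AlgHom.toLinearMap_apply, map_mul, theta_hy, mul_neg,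
      map_neg]
    simp only [Nat.sub_self, mul_zero, pow_zero, one_mul, pow_one] at this
    linear_combination -this

theorem one_le_of_mem_interleave {r : ℕ} {l k : Fin r → ℕ} (hl : ∀ i, 1 ≤ l i)
    (hk : ∀ i, 1 ≤ k i) : ∀ m ∈ interleave l k, 1 ≤ m := by
  induction r with
  | zero => simp [interleave]
  | succ r ih =>
    rw [interleave_succ]
    simp only [List.mem_cons]
    rintro m (rfl | rfl | hm)
    · exact hl 0
    · exact hk 0
    · exact ih (fun i => hl i.succ) (fun i => hk i.succ) m hm

theorem even_length_interleave {r : ℕ} (l k : Fin r → ℕ) : Even (interleave l k).length := by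
  induction r with
  | zero => simp [interleave]
  | succ r ih =>
    rw [interleave_succ]
    simpa [Nat.even_add_one] using ih (Fin.tail l) (Fin.tail k)

end QMZV

theorem theorem1p2 (N : ℕ) (hN : 1 ≤ N) (r : ℕ) (l k : Fin r → ℕ)
    (hl : ∀ i, 1 ≤ l i) (hk : ∀ i, 1 ≤ k i) :
    QMZV.zetaDagger N (QMZV.daggerIndex l k)
        = QMZV.ZDagger N (QMZV.frakE (QMZV.interleave l k)) ∧
      QMZV.zetaDiamondBZ N (QMZV.diamondIndex l k)
        = QMZV.ZBZ N (Submodule.inclusion QMZV.Hge2_le_H1 (QMZV.frakD (QMZV.interleave l k))) := by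
  have hc := QMZV.one_le_of_mem_interleave hl hk
  have he := QMZV.even_length_interleave l k
  -- The sums over `N - 1` sites start at index `1`, so they are the full truncated values.
  have h1 : N - (N - 1) = 1 := by omega
  constructor
  · have h := QMZV.truncated_eq_iterated (by norm_num) QMZV.isTruncated_dagger
      (fun m n hm hn => QMZV.qinv_add hm hn) QMZV.isIterated_dagger hN _ hc he
    rw [h1, QMZV.daggerList_interleave, ← QMZV.zetaDagger_eq] at h
    exact h
  · have h := QMZV.truncated_eq_iterated le_rfl QMZV.isTruncated_diamond
      (fun m n hm hn => by linear_combination QMZV.qinv_add hm hn) QMZV.isIterated_BZ hN _ hc he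
    rw [h1, QMZV.diamondList_interleave, ← QMZV.zetaDiamondBZ_eq] at h
    have e : QMZV.ZBZ N (Submodule.inclusion QMZV.Hge2_le_H1
        (QMZV.frakD (QMZV.interleave l k)))
        = QMZV.onWords (fun k => QMZV.zetaBZ N k) ((-1 : ℤ) ^ (QMZV.interleave l k).sum
          • QMZV.theta (QMZV.wordE 1 (QMZV.interleave l k))) := rfl
    have hs : ((-1 : PowerSeries ℤ) ^ (QMZV.interleave l k).sum)
        * (-1) ^ (QMZV.interleave l k).sum = 1 := by
      rw [← mul_pow]; simp
    rw [e, map_smul, zsmul_eq_mul]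
    push_cast
    rw [LinearMap.comp_apply, AlgHom.toLinearMap_apply] at h
    linear_combination (-1) ^ (QMZV.interleave l k).sum * h
      - QMZV.zetaDiamondBZ N (QMZV.diamondIndex l k) * hs
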